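/- **Setting.** There are $n$ bidders. Bidder $i$'s type is drawn independently from a compact interval $\Theta_i=[a_i,b_i]\subset\mathbf R_+$, $a_i<b_i$, with a continuous strictly positive density and distribution function $F_i$. Selling to type $\theta$ with probability $x\in[0,1]$ yields revenue $J_i(x,\theta)$, where $J_i$ is twice continuously differentiable on $[0,1]\times\Theta_i$ and $\partial J_i/\partial x\not\equiv 0$. Put $H_i(x,u)=J_i(x,F_i^{-1}(u))$ for $u\in[0,1]$. A *reduced form* is a tuple $\boldsymbol x=(x_1,\dots,x_n)$ of functions $x_i:[0,1]\to[0,1]$ that are weakly increasing and right-continuous with $x_i(1)=1$. It is *feasible* if $\prod_i u_i+\sum_i\int_{u_i}^1x_i(u)\,du\le1$ for all $\boldsymbol u\in[0,1]^n$, and *optimal* if it maximizes $\sum_i\int_0^1H_i(x_i(u),u)\,du$ among feasible reduced forms. An *allocation* is a measurable $\boldsymbol z:[0,1]^n\to[0,1]^n$ with $\sum_iz_i\le1$; it *induces* $\boldsymbol x$ if $x_i(u_i)=\mathbf E[z_i\mid u_i]$ almost surely, for all $i$, where $u_1,\dots,u_n$ are independent and uniform on $[0,1]$. The *$\delta$-transform*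 of $x_i$ is $\delta_i(t)=-\ln\psi_i(e^{-t})$, $t\ge0$, with $\psi_i(\iota)=\sup\{u\in[0,1]:u\,x_i(u)\le\iota\}$. Conversely, from (a piece of) a path $\delta$ one recovers, for $u>0$, $x(u)=e^{\delta(t)-t}$ with $t$ the first time at which $\delta(t)=-\ln u$, and $x(u)=0$ if there is no such time; $x(0)$ is the right limit at $0$. For $0\le\delta\le t$ let $R_i(\delta,t)=\int_0^\delta\frac{\partial H_i}{\partial x}(e^{\tau-t},e^{-\tau})\,d\tau$, so that $\frac{\partial R_i}{\partial\delta}(\delta,t)=\frac{\partial H_i}{\partial x}(e^{\delta-t},e^{-\delta})$. The environment is *regular* if (A) each $R_i(\cdot,t)$ is strictly concave on $[0,t]$, and (B) for each $t\ge0$ the system $\frac{\partial R_i}{\partial\delta}(\delta_i,t)=p$ $(i=1,\dots,n)$, $\sum_i\delta_i=t$, $\delta_i\ge 0$, has a unique solution $(\boldsymbol\delta^\sharp(t),p^\sharp(t))$, and every $\delta_i^\sharp$ is strictly increasing and $p^\sharp$ is strictly decreasing in $t$. Let $T=\inf\{t\ge0:p^\sharp(t)\le0\}\in[0,\infty]$.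 A *fractional score allocation* with scores $\boldsymbol q$ (each $q_i:[0,1]\to\mathbf R$ strictly increasing and right-continuous) and winning fractions $\boldsymbol r$ (each $r_i:[0,1]\to[0,1]$ right-continuous) is $z_i(\boldsymbol u)=r_i(u_i)$ if $q_i(u_i)>q_j(u_j)$ for all $j\ne i$, and $z_i(\boldsymbol u)=0$ otherwise. **Theorem 5.** Consider a regular environment. Suppose that for each $i$ there is a function $\delta_i^\dagger:[T,\infty)\to\mathbf R$ with $0\le\delta_i^\dagger(t)\le t$ and $\frac{\partial R_i}{\partial\delta}(\delta_i^\dagger(t),t)=0$ for all $t\ge T$, which is weakly increasing with slope at most one (i.e. $0\le\delta_i^\dagger(t)-\delta_i^\dagger(s)\le t-s$ for $T\le s\le t$). Then there is an optimal reduced form $\boldsymbol x^*$ whose $\delta$-transforms $\boldsymbol\delta^*$ coincide with $\boldsymbol\delta^\sharp$ on $[0,T)$ and with $\boldsymbol\delta^\dagger$ on $[T,\infty)$. Furthermore, there are scores $\boldsymbol q^*$ with $q_i^*(u)=p^\sharp\big((\delta_i^\sharp)^{-1}(-\ln u)\big)$ for every $u$ in the range of $t\mapsto e^{-\delta_i^\sharp(t)}$,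 $t\ge0$, and for every such tuple of scores $\boldsymbol x^*$ is induced by the fractional score allocation with scores $\boldsymbol q^*$ and winning fractions $$r_i^*(u)=\begin{cases}1,&u\ge e^{-\delta_i^*(T)},\\ x_i^\dagger(u)/x_i^\sharp(u),&\text{otherwise,}\end{cases}$$ which are right-continuous with values in $[0,1]$. Here $x_i^\sharp(u)$ is the probability that $q_i^*(u)>q_j^*(u_j)$ for all $j\ne i$, $x_i^\dagger$ is recovered from $\delta_i^\dagger$ as above, and $0/0=0$. If $T=\infty$, then $e^{-\delta_i^*(T)}$ is read as $\lim_{t\to\infty}e^{-\delta_i^\sharp(t)}$ and $r_i^*=0$ below it. -/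

import Mathlib

open MeasureTheory Set Filter Topology

noncomputable section

/-- The primitives of the auction model with `n` bidders: compact type intervals in the nonnegative
reals, strictly positive continuous type densities on them, and twice continuously differentiable
revenue functions `J i x θ` (the revenue from selling to type `θ` of bidder `i` with probability
`x`) whose derivative with respect to `x` is not identically zero. Only the values on the displayed
domains matter. -/
structure AuctionEnv (n : ℕ) where
  /-- lower end of the type interval -/
  lo : Fin n → ℝ
  /-- upper end of the type interval -/
  hi : Fin n → ℝ
  lo_nonneg : ∀ i, 0 ≤ lo i
  lo_lt_hi : ∀ i, lo i < hi i
  /-- type density -/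
  f : Fin n → ℝ → ℝ
  f_continuous : ∀ i, ContinuousOn (f i) (Icc (lo i) (hi i))
  f_pos : ∀ i, ∀ θ ∈ Icc (lo i) (hi i), 0 < f i θ
  f_integral : ∀ i, ∫ θ in (lo i)..(hi i), f i θ = 1
  /-- revenue from selling to a type with a given probability -/
  J : Fin n → ℝ → ℝ → ℝ
  J_contDiff : ∀ i, ContDiffOn ℝ 2 (fun p : ℝ × ℝ => J i p.1 p.2)
    (Icc (0 : ℝ) 1 ×ˢ Icc (lo i) (hi i))
  J_nontrivial : ∀ i, ∃ x ∈ Icc (0 : ℝ) 1, ∃ θ ∈ Icc (lo i) (hi i),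
    derivWithin (fun y => J i y θ) (Icc 0 1) x ≠ 0

/-- Right-continuity of a function on the unit interval. -/
def RightCts (g : ℝ → ℝ) : Prop :=
  ∀ u ∈ Ico (0 : ℝ) 1, ContinuousWithinAt g (Ici u) u

/-- Cumulative distribution functions on the unit interval. -/
def IsCDF (x : ℝ → ℝ) : Prop :=
  (∀ u ∈ Icc (0 : ℝ) 1, x u ∈ Icc (0 : ℝ) 1) ∧ MonotoneOn x (Icc 0 1) ∧ RightCts x ∧ x 1 = 1

/-- The `ψ`-transform of `x`: the right-continuous generalized inverse of `u ↦ u * x u`. -/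
def psiTransform (x : ℝ → ℝ) (ι : ℝ) : ℝ :=
  sSup {u : ℝ | u ∈ Icc (0 : ℝ) 1 ∧ u * x u ≤ ι}

/-- The `δ`-transform of `x`. -/
def deltaTransform (x : ℝ → ℝ) (t : ℝ) : ℝ :=
  -Real.log (psiTransform x (Real.exp (-t)))

/-- For `u > 0`: the highest second coordinate of a point with first coordinate `u` on the curve
`t ↦ (exp (-δ t), exp (δ t - t))`, `t ∈ S`, and `0` if the curve has no such point. -/
def cdfOfDeltaPos (S : Set ℝ) (δ : ℝ → ℝ) (u : ℝ) : ℝ :=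
  sSup {y : ℝ | ∃ t ∈ S, Real.exp (-δ t) = u ∧ y = Real.exp (δ t - t)}

/-- The winning probability recovered from a (piece of a) `δ`-transform given on the set `S` of
times; the value at `u = 0` is the right limit there. -/
def cdfOfDelta (S : Set ℝ) (δ : ℝ → ℝ) (u : ℝ) : ℝ :=
  if 0 < u then cdfOfDeltaPos S δ u else limUnder (𝓝[>] (0 : ℝ)) (cdfOfDeltaPos S δ)

/-- The left-hand side of Border's constraint. -/
def borderValue {n : ℕ} (x : Fin n → ℝ → ℝ) (u : Fin n → ℝ) : ℝ :=
  ∏ i, u i + ∑ i, ∫ v in (u i)..1, x i v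

/-- Feasible reduced forms: tuples of distribution functions that satisfy Border's constraint. -/
def IsFeasible {n : ℕ} (x : Fin n → ℝ → ℝ) : Prop :=
  (∀ i, IsCDF (x i)) ∧ ∀ u : Fin n → ℝ, (∀ i, u i ∈ Icc (0 : ℝ) 1) → borderValue x u ≤ 1

/-- Allocations in the space of quantiles. -/
def IsAllocation {n : ℕ} (z : (Fin n → ℝ) → Fin n → ℝ) : Prop :=
  (∀ i, Measurable ((Icc (0 : Fin n → ℝ) 1).domRestrict fun u => z u i)) ∧
  ∀ u ∈ Icc (0 : Fin n → ℝ) 1, (∀ i, z u i ∈ Icc (0 : ℝ) 1) ∧ ∑ i, z u i ≤ 1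

/-- The interim winning probability of quantile `u` of bidder `i`: the expectation of `z i` over
the independent uniform quantiles of the other bidders, with bidder `i`'s own quantile set to `u`
(the integral over the overwritten `i`-th coordinate contributes a factor `1`). -/
def interim {n : ℕ} (z : (Fin n → ℝ) → Fin n → ℝ) (i : Fin n) (u : ℝ) : ℝ :=
  ∫ v in Icc (0 : Fin n → ℝ) 1, z (Function.update v i u) i

/-- The allocation `z` induces the reduced form `x`. -/
def Induces {n : ℕ} (z : (Fin n → ℝ) → Fin n → ℝ) (x : Fin n → ℝ → ℝ) : Prop :=
  IsAllocation z ∧ ∀ i, ∀ᵐ u ∂(volume.restrict (Icc (0 : ℝ) 1)), x i u = interim z i u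

/-- Tuples of scores. -/
def IsScores {n : ℕ} (q : Fin n → ℝ → ℝ) : Prop :=
  ∀ i, StrictMonoOn (q i) (Icc 0 1) ∧ RightCts (q i)

/-- Tuples of winning fractions. -/
def IsFractions {n : ℕ} (r : Fin n → ℝ → ℝ) : Prop :=
  ∀ i, (∀ u ∈ Icc (0 : ℝ) 1, r i u ∈ Icc (0 : ℝ) 1) ∧ RightCts (r i)

open Classical in
/-- The allocation in which the bidder with the strictly highest score wins with the probability
given by that bidder's winning fraction. -/
def fractionalScoreAllocation {n : ℕ} (q r : Fin n → ℝ → ℝ) (u : Fin n → ℝ) (i : Fin n) : ℝ :=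
  if ∀ j, j ≠ i → q j (u j) < q i (u i) then r i (u i) else 0

namespace AuctionEnv

variable {n : ℕ} (E : AuctionEnv n)

/-- The distribution function of bidder `i`'s type. -/
def F (i : Fin n) (θ : ℝ) : ℝ := ∫ s in (E.lo i)..θ, E.f i s

/-- The inverse of the distribution function of bidder `i`'s type. -/
def quantile (i : Fin n) (u : ℝ) : ℝ :=
  sSup {θ : ℝ | θ ∈ Icc (E.lo i) (E.hi i) ∧ E.F i θ ≤ u}

/-- The revenue function in the space of quantiles. -/
def H (i : Fin n) (x u : ℝ) : ℝ := E.J i x (E.quantile i u)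

/-- The derivative of `H i` in its first argument, which runs over the unit interval. -/
def dH (i : Fin n) (x u : ℝ) : ℝ := derivWithin (fun y => E.H i y u) (Icc 0 1) x

/-- Expected revenue of a reduced form. -/
def revenue (x : Fin n → ℝ → ℝ) : ℝ := ∑ i, ∫ u in (0 : ℝ)..1, E.H i (x i u) u

/-- Optimal reduced forms. -/
def IsOptimal (x : Fin n → ℝ → ℝ) : Prop :=
  IsFeasible x ∧ ∀ y, IsFeasible y → E.revenue y ≤ E.revenue x

/-- The transformed revenue function `R i δ t`, for `0 ≤ δ ≤ t`. -/
def R (i : Fin n) (δ t : ℝ) : ℝ :=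
  ∫ τ in (0 : ℝ)..δ, E.dH i (Real.exp (τ - t)) (Real.exp (-τ))

/-- The marginal revenue, i.e. the derivative of `R i δ t` in `δ` (see
`AuctionEnv.hasDerivWithinAt_R`), for `0 ≤ δ ≤ t`. -/
def marginalRevenue (i : Fin n) (δ t : ℝ) : ℝ :=
  E.dH i (Real.exp (δ - t)) (Real.exp (-δ))

theorem F_strictMonoOn (i : Fin n) : StrictMonoOn (E.F i) (Icc (E.lo i) (E.hi i)) := by
  intro a ha b hb hab
  have hint : ∀ c ∈ Icc (E.lo i) (E.hi i), ∀ d ∈ Icc (E.lo i) (E.hi i),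
      IntervalIntegrable (E.f i) volume c d := fun c hc d hd =>
    ((E.f_continuous i).mono (ordConnected_Icc.uIcc_subset hc hd)).intervalIntegrable
  have hlo : E.lo i ∈ Icc (E.lo i) (E.hi i) := left_mem_Icc.2 (E.lo_lt_hi i).le
  have hpos : 0 < ∫ s in a..b, E.f i s :=
    intervalIntegral.intervalIntegral_pos_of_pos_on (hint a ha b hb)
      (fun s hs => E.f_pos i s ⟨ha.1.trans hs.1.le, hs.2.le.trans hb.2⟩) hab
  have hadd := intervalIntegral.integral_add_adjacent_intervals
    (hint _ hlo a ha) (hint a ha b hb)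
  unfold F
  linarith

theorem quantile_F (i : Fin n) {θ : ℝ} (hθ : θ ∈ Icc (E.lo i) (E.hi i)) :
    E.quantile i (E.F i θ) = θ := by
  have : {θ' : ℝ | θ' ∈ Icc (E.lo i) (E.hi i) ∧ E.F i θ' ≤ E.F i θ} = Icc (E.lo i) θ := by
    ext s
    constructor
    · rintro ⟨hs, h⟩
      exact ⟨hs.1, ((E.F_strictMonoOn i).le_iff_le hs hθ).1 h⟩
    · rintro ⟨h1, h2⟩
      have hs : s ∈ Icc (E.lo i) (E.hi i) := ⟨h1, h2.trans hθ.2⟩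
      exact ⟨hs, ((E.F_strictMonoOn i).le_iff_le hs hθ).2 h2⟩
  rw [quantile, this, csSup_Icc hθ.1]

theorem F_continuousOn (i : Fin n) : ContinuousOn (E.F i) (Icc (E.lo i) (E.hi i)) := by
  have h := E.f_continuous i
  rw [← uIcc_of_le (E.lo_lt_hi i).le] at h ⊢
  exact intervalIntegral.continuousOn_primitive_interval (h.integrableOn_compact isCompact_uIcc)

theorem exists_F_eq (i : Fin n) {u : ℝ} (hu : u ∈ Icc (0 : ℝ) 1) :
    ∃ θ ∈ Icc (E.lo i) (E.hi i), E.F i θ = u := by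
  have h := intermediate_value_Icc (E.lo_lt_hi i).le (E.F_continuousOn i)
  have h0 : E.F i (E.lo i) = 0 := by simp [F]
  have h1 : E.F i (E.hi i) = 1 := E.f_integral i
  rw [h0, h1] at h
  exact h hu

theorem quantile_mem (i : Fin n) {u : ℝ} (hu : u ∈ Icc (0 : ℝ) 1) :
    E.quantile i u ∈ Icc (E.lo i) (E.hi i) := by
  obtain ⟨θ, hθ, rfl⟩ := E.exists_F_eq i hu
  rwa [E.quantile_F i hθ]

theorem F_mem (i : Fin n) {θ : ℝ} (hθ : θ ∈ Icc (E.lo i) (E.hi i)) :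
    E.F i θ ∈ Icc (0 : ℝ) 1 := by
  have h0 : E.F i (E.lo i) = 0 := by simp [F]
  have h1 : E.F i (E.hi i) = 1 := E.f_integral i
  have hm := (E.F_strictMonoOn i).monotoneOn
  have hl : E.lo i ∈ Icc (E.lo i) (E.hi i) := left_mem_Icc.2 (E.lo_lt_hi i).le
  have hh : E.hi i ∈ Icc (E.lo i) (E.hi i) := right_mem_Icc.2 (E.lo_lt_hi i).le
  exact ⟨h0 ▸ hm hl hθ hθ.1, h1 ▸ hm hθ hh hθ.2⟩

theorem quantile_continuousOn (i : Fin n) : ContinuousOn (E.quantile i) (Icc 0 1) := by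
  rw [continuousOn_iff_isClosed]
  intro C hC
  refine ⟨E.F i '' (Icc (E.lo i) (E.hi i) ∩ C), ?_, ?_⟩
  · exact ((isCompact_Icc.inter_right hC).image_of_continuousOn
      ((E.F_continuousOn i).mono inter_subset_left)).isClosed
  · ext u
    constructor
    · rintro ⟨h1, h2⟩
      obtain ⟨θ, hθ, rfl⟩ := E.exists_F_eq i h2
      rw [mem_preimage, E.quantile_F i hθ] at h1
      exact ⟨⟨θ, ⟨hθ, h1⟩, rfl⟩, h2⟩
    · rintro ⟨⟨θ, ⟨hθ, hC'⟩, rfl⟩, h2⟩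
      refine ⟨?_, h2⟩
      rwa [mem_preimage, E.quantile_F i hθ]

theorem dH_continuousOn (i : Fin n) :
    ContinuousOn (fun p : ℝ × ℝ => E.dH i p.1 p.2) (Icc (0 : ℝ) 1 ×ˢ Icc (0 : ℝ) 1) := by
  set D : Set (ℝ × ℝ) := Icc (0 : ℝ) 1 ×ˢ Icc (E.lo i) (E.hi i) with hD
  have hU : UniqueDiffOn ℝ D :=
    (uniqueDiffOn_Icc zero_lt_one).prod (uniqueDiffOn_Icc (E.lo_lt_hi i))
  have hJ := E.J_contDiff i
  have hc := hJ.continuousOn_fderivWithin hU (by norm_num)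
  have hφ : ContinuousOn (fun p : ℝ × ℝ => (p.1, E.quantile i p.2))
      (Icc (0 : ℝ) 1 ×ˢ Icc (0 : ℝ) 1) :=
    continuousOn_fst.prodMk ((E.quantile_continuousOn i).comp continuousOn_snd fun p hp => hp.2)
  have hmaps : MapsTo (fun p : ℝ × ℝ => (p.1, E.quantile i p.2))
      (Icc (0 : ℝ) 1 ×ˢ Icc (0 : ℝ) 1) D := fun p hp => ⟨hp.1, E.quantile_mem i hp.2⟩
  refine ((hc.comp hφ hmaps).clm_apply
    (continuousOn_const (c := ((1 : ℝ), (0 : ℝ))))).congr fun p hp => ?_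
  have hd : HasFDerivWithinAt (fun p : ℝ × ℝ => E.J i p.1 p.2) _ D (p.1, E.quantile i p.2) :=
    ((hJ.differentiableOn (by norm_num)) _ (hmaps hp)).hasFDerivWithinAt
  have hl : HasDerivWithinAt (fun y : ℝ => (y, E.quantile i p.2)) ((1 : ℝ), (0 : ℝ))
      (Icc 0 1) p.1 := (hasDerivWithinAt_id _ _).prodMk (hasDerivWithinAt_const _ _ _)
  have hm : MapsTo (fun y : ℝ => (y, E.quantile i p.2)) (Icc 0 1) D :=
    fun y hy => ⟨hy, E.quantile_mem i hp.2⟩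
  exact (hd.comp_hasDerivWithinAt p.1 hl hm).derivWithin (uniqueDiffOn_Icc zero_lt_one _ hp.1)

/-- The marginal revenue is the derivative of the transformed revenue function. -/
theorem hasDerivWithinAt_R (i : Fin n) {δ t : ℝ} (h : δ ∈ Icc 0 t) :
    HasDerivWithinAt (fun δ => E.R i δ t) (E.marginalRevenue i δ t) (Icc 0 t) δ := by
  have hg : ContinuousOn (fun τ => E.dH i (Real.exp (τ - t)) (Real.exp (-τ))) (Icc 0 t) := by
    refine (E.dH_continuousOn i).comp (f := fun τ : ℝ => (Real.exp (τ - t), Real.exp (-τ)))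
      (by fun_prop) fun τ hτ => ⟨⟨(Real.exp_pos _).le, ?_⟩, ⟨(Real.exp_pos _).le, ?_⟩⟩
    · exact Real.exp_le_one_iff.2 (by linarith [hτ.2])
    · exact Real.exp_le_one_iff.2 (by linarith [hτ.1])
  have : Fact (δ ∈ Icc 0 t) := ⟨h⟩
  refine intervalIntegral.integral_hasDerivWithinAt_right ?_
    (hg.stronglyMeasurableAtFilter_nhdsWithin measurableSet_Icc δ) (hg δ h)
  refine (hg.mono ?_).intervalIntegrable
  rw [uIcc_of_le h.1]
  exact Icc_subset_Icc_right h.2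

/-- `(δ, p)` solves at time `t` the system of equalized marginal revenues with total height `t`.
The constraints give `0 ≤ δ i ≤ t`, the domain of `R i` at time `t`. -/
def SolvesFOC (t : ℝ) (δ : Fin n → ℝ) (p : ℝ) : Prop :=
  (∀ i, 0 ≤ δ i) ∧ (∀ i, E.marginalRevenue i (δ i) t = p) ∧ ∑ i, δ i = t

/-- `(δ, p)` is a path of solutions to the system over all times. -/
def IsSharpPath (δ : Fin n → ℝ → ℝ) (p : ℝ → ℝ) : Prop :=
  ∀ t, 0 ≤ t → E.SolvesFOC t (fun i => δ i t) (p t)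

/-- Regular environments. -/
structure IsRegular : Prop where
  concave : ∀ i t, 0 ≤ t → StrictConcaveOn ℝ (Icc 0 t) (fun δ => E.R i δ t)
  unique : ∀ t, 0 ≤ t → ∃! s : (Fin n → ℝ) × ℝ, E.SolvesFOC t s.1 s.2
  monotone : ∀ δ p, E.IsSharpPath δ p →
    (∀ i, StrictMonoOn (δ i) (Ici 0)) ∧ StrictAntiOn p (Ici 0)

/-- On `[T, ∞)`, each `δ i` is the path on which the marginal revenue of bidder `i` is zero. -/
def IsDaggerPath (T : EReal) (δ : Fin n → ℝ → ℝ) : Prop :=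
  ∀ i (t : ℝ), T ≤ (t : EReal) → δ i t ∈ Icc 0 t ∧ E.marginalRevenue i (δ i t) t = 0

end AuctionEnv

/-- The cutoff time `inf {t ≥ 0 : p t ≤ 0}`, which is `∞` if the set is empty. -/
def cutoff (p : ℝ → ℝ) : EReal :=
  sInf ((fun t : ℝ => (t : EReal)) '' {t : ℝ | 0 ≤ t ∧ p t ≤ 0})

open Classical in
/-- The path that follows `δs` before the time `T` and `δd` from the time `T` on. -/
def optimalDelta {n : ℕ} (T : EReal) (δs δd : Fin n → ℝ → ℝ) (i : Fin n) (t : ℝ) : ℝ :=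
  if (t : EReal) < T then δs i t else δd i t

open Classical in
/-- The threshold quantile `exp (-δ* T)`, read as a limit (an infimum) if `T = ∞`. -/
def thresholdQuantile {n : ℕ} (T : EReal) (δs δd : Fin n → ℝ → ℝ) (i : Fin n) : ℝ :=
  if T = ⊤ then ⨅ t : Ici (0 : ℝ), Real.exp (-optimalDelta T δs δd i t)
  else Real.exp (-optimalDelta T δs δd i T.toReal)

/-- The principal virtual values: scores with `q i (exp (-δ i t)) = p t` for all `t ≥ 0`, that is
`q i u = p ((δ i)⁻¹ (-log u))` for every `u` for which the right-hand side is meaningful. -/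
def IsPrincipalVirtualValue {n : ℕ} (δ : Fin n → ℝ → ℝ) (p : ℝ → ℝ) (q : Fin n → ℝ → ℝ) : Prop :=
  IsScores q ∧ ∀ i t, 0 ≤ t → q i (Real.exp (-δ i t)) = p t

open Classical in
/-- The optimal winning fractions. The denominator is the interim probability of having the highest
score. -/
def optimalFraction {n : ℕ} (T : EReal) (δs δd : Fin n → ℝ → ℝ) (q : Fin n → ℝ → ℝ)
    (i : Fin n) (u : ℝ) : ℝ :=
  if thresholdQuantile T δs δd i ≤ u then 1
  else cdfOfDelta {t : ℝ | T ≤ (t : EReal)} (δd i) u /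
    interim (fractionalScoreAllocation q fun _ _ => 1) i u

end

/-! Write points below the graph of `x i` as u = e^{-τ}, y = e^{τ-t}. Here t labels the hyperbola
u·y = e^{-t}, and the δ-transform at t tells how far along it the region below the graph extends.
The Jacobian is e^{-t}, so revenue is a constant plus ∫ e^{-t} ∑ R_i(δ_i(t), t) dt
(`AuctionEnv.integral_H_eq`): concave, and separable across times. Border's constraint at the
quantiles e^{-δ_i(t)} implies ∫_0^t e^{-s}(∑ δ_i(s) - s) ds ≤ 0 for every t
(`IsFeasible.integral_exp_neg_mul_sub_nonpos`), and nothing more is needed about competitors. A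
nonincreasing nonnegative multiplier combines these inequalities into one
(`integral_antitone_mul_nonpos`), so equal marginal revenues and complementary slackness suffice for
optimality (`AuctionEnv.IsRegular.isOptimal_of_multiplier`). The multiplier is the positive part of
p♯: the sharp path fits it before T and the dagger path from T on. The two paths meet at T, so the
spliced path increases with slope at most one. Every such path starting at 0 is the δ-transform of
the distribution function it encodes (`IsDeltaPath.isCDF`, `IsDeltaPath.deltaTransform_cdfOfDelta`).
Feasibility comes from an explicit allocation (`Induces.borderValue_le_one`). With the prescribed
scores, the highest-score probability at e^{-δ♯_i(t)} is e^{δ♯_i(t)-t}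
(`AuctionEnv.IsSharpPath.highScoreProb_exp`), which is already the optimal form above the threshold.
Below it p♯ ≤ 0 forces δ† ≤ δ♯, so the optimal form is a fraction of that probability. The delicate
point is right-continuity of this fraction where the denominator vanishes
(`AuctionEnv.IsSharpPath.eventually_optimalForm_eq_zero`). -/

/-! ### δ-paths and the distribution functions they encode -/

/-- Paths that start at `0` and are weakly increasing with slope at most one. -/
structure IsDeltaPath (δ : ℝ → ℝ) : Prop where
  zero : δ 0 = 0
  mono : ∀ s t, 0 ≤ s → s ≤ t → δ s ≤ δ t
  slope : ∀ s t, 0 ≤ s → s ≤ t → δ t - δ s ≤ t - s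

namespace IsDeltaPath

variable {δ : ℝ → ℝ}

theorem nonneg (h : IsDeltaPath δ) {t : ℝ} (ht : 0 ≤ t) : 0 ≤ δ t :=
  h.zero ▸ h.mono 0 t le_rfl ht

theorem le_self (h : IsDeltaPath δ) {t : ℝ} (ht : 0 ≤ t) : δ t ≤ t := by
  have := h.slope 0 t le_rfl ht
  rw [h.zero] at this
  linarith

theorem continuousOn (h : IsDeltaPath δ) : ContinuousOn δ (Ici 0) := by
  refine (LipschitzOnWith.of_le_add_mul 1 fun s hs t ht => ?_).continuousOn
  simp only [mem_Ici] at hs ht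
  rw [NNReal.coe_one, one_mul, Real.dist_eq]
  rcases le_total s t with hst | hst
  · linarith [h.mono s t hs hst, abs_nonneg (s - t)]
  · linarith [h.slope t s ht hst, le_abs_self (s - t)]

theorem exists_eq (h : IsDeltaPath δ) {s t : ℝ} (ht : 0 ≤ t) (hs : 0 ≤ s) (hst : s ≤ δ t) :
    ∃ t' ∈ Icc 0 t, δ t' = s := by
  have := intermediate_value_Icc ht (h.continuousOn.mono Icc_subset_Ici_self)
  rw [h.zero] at this
  exact this ⟨hs, hst⟩

theorem cdfSet_le_one (h : IsDeltaPath δ) {u y : ℝ}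
    (hy : y ∈ {y : ℝ | ∃ t ∈ {t : ℝ | 0 ≤ t}, Real.exp (-δ t) = u ∧ y = Real.exp (δ t - t)}) :
    y ≤ 1 := by
  obtain ⟨t, ht, -, rfl⟩ := hy
  exact Real.exp_le_one_iff.2 (by linarith [h.le_self ht])

theorem cdfOfDelta_nonneg_of_pos {S : Set ℝ} {u : ℝ} (hu : 0 < u) : 0 ≤ cdfOfDelta S δ u := by
  rw [cdfOfDelta, if_pos hu]
  refine Real.sSup_nonneg ?_
  rintro y ⟨t, -, -, rfl⟩
  exact (Real.exp_pos _).le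

theorem cdfOfDelta_le_one_of_pos (h : IsDeltaPath δ) {u : ℝ} (hu : 0 < u) :
    cdfOfDelta {t | 0 ≤ t} δ u ≤ 1 := by
  rw [cdfOfDelta, if_pos hu]
  exact Real.sSup_le (fun y hy => h.cdfSet_le_one hy) zero_le_one

/-- The hyperbola of level `exp (-t)` passes below the graph at `u` iff the path has reached
`-log u` by the time `t`. -/
theorem exp_neg_le_mul_cdfOfDelta_iff (h : IsDeltaPath δ) {u t : ℝ} (hu : 0 < u) (hu1 : u ≤ 1)
    (ht : 0 ≤ t) :
    Real.exp (-t) ≤ u * cdfOfDelta {t | 0 ≤ t} δ u ↔ -Real.log u ≤ δ t := by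
  have hs : 0 ≤ -Real.log u := by linarith [Real.log_nonpos hu.le hu1]
  have hue : Real.exp (Real.log u) = u := Real.exp_log hu
  rw [cdfOfDelta, if_pos hu]
  constructor
  · intro hle
    by_contra! hlt
    -- By the slope bound the path cannot close the gap to -log u before t', half a gap after t. The
    -- strict delay is needed because a supremum inherits only weak bounds.
    set t' := t + (-Real.log u - δ t) / 2 with ht'
    have htt' : t < t' := by linarith
    have hδ : δ t' < -Real.log u := by linarith [h.slope t t' ht htt'.le]
    have hsup : cdfOfDeltaPos {t | 0 ≤ t} δ u ≤ Real.exp (-t') / u := by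
      refine Real.sSup_le ?_ (by positivity)
      rintro y ⟨r, hr, hru, rfl⟩
      have hδr : δ r = -Real.log u := by rw [← hru, Real.log_exp]; ring
      have : t' ≤ r := by
        by_contra! hrt
        linarith [h.mono r t' hr hrt.le]
      rw [le_div_iff₀ hu]
      nth_rewrite 1 [← hue]
      rw [← Real.exp_add, hδr]
      exact Real.exp_le_exp.2 (by linarith)
    rw [le_div_iff₀ hu] at hsup
    have := Real.exp_lt_exp.2 (neg_lt_neg htt')
    linarith
  · intro hle
    obtain ⟨t', ⟨ht'0, ht't⟩, hδ⟩ := h.exists_eq ht hs hle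
    have hmem : Real.exp (δ t' - t') ≤ cdfOfDeltaPos {t | 0 ≤ t} δ u := by
      refine le_csSup ⟨1, fun y hy => h.cdfSet_le_one hy⟩ ⟨t', ht'0, ?_, rfl⟩
      rw [hδ, neg_neg, hue]
    calc Real.exp (-t) ≤ Real.exp (-t') := Real.exp_le_exp.2 (by linarith)
      _ = u * Real.exp (δ t' - t') := by
        nth_rewrite 1 [← hue]
        rw [← Real.exp_add, hδ]
        congr 1
        ring
      _ ≤ _ := mul_le_mul_of_nonneg_left hmem hu.le

/-- The value at a point that the path reaches for the first time at `t`. -/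
theorem cdfOfDelta_exp (h : IsDeltaPath δ) {t : ℝ} (ht : 0 ≤ t)
    (hfirst : ∀ s, 0 ≤ s → s < t → δ s < δ t) :
    cdfOfDelta {t | 0 ≤ t} δ (Real.exp (-δ t)) = Real.exp (δ t - t) := by
  have hu := Real.exp_pos (-δ t)
  rw [cdfOfDelta, if_pos hu]
  refine le_antisymm (Real.sSup_le ?_ (Real.exp_pos _).le)
    (le_csSup ⟨1, fun y hy => h.cdfSet_le_one hy⟩ ⟨t, ht, rfl, rfl⟩)
  rintro y ⟨r, hr, hru, rfl⟩
  have hδ : δ r = δ t := by simpa using hru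
  have : t ≤ r := by
    by_contra! hrt
    linarith [hfirst r hr hrt]
  exact Real.exp_le_exp.2 (by linarith)

/-- A continuous path that reaches the height -log u has passed the lower height -log v earlier, and
δ t - t is nonincreasing. If the path never reaches -log u, the value at u is the supremum of the
empty set, which is 0. -/
theorem cdfOfDelta_monotoneOn_Ioc (h : IsDeltaPath δ) :
    MonotoneOn (cdfOfDelta {t | 0 ≤ t} δ) (Ioc 0 1) := by
  intro u hu v hv huv
  rw [cdfOfDelta, cdfOfDelta, if_pos hu.1, if_pos hv.1]
  refine Real.sSup_le ?_ (Real.sSup_nonneg ?_)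
  · rintro y ⟨t, ht, htu, rfl⟩
    have hδ : δ t = -Real.log u := by rw [← htu, Real.log_exp]; ring
    have hlog := Real.log_le_log hu.1 huv
    obtain ⟨t', ⟨ht'0, ht't⟩, hδ'⟩ := h.exists_eq (s := -Real.log v) ht
      (by linarith [Real.log_nonpos hv.1.le hv.2]) (by linarith)
    refine le_trans (Real.exp_le_exp.2 ?_) (le_csSup ⟨1, fun y hy => h.cdfSet_le_one hy⟩
      ⟨t', ht'0, by rw [hδ', neg_neg, Real.exp_log hv.1], rfl⟩)
    linarith [h.slope t' t ht'0 ht't]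
  · rintro y ⟨t, -, -, rfl⟩
    exact (Real.exp_pos _).le

theorem cdfOfDelta_rightCts_pos (h : IsDeltaPath δ) {u : ℝ} (hu : u ∈ Ioo (0 : ℝ) 1) :
    ContinuousWithinAt (cdfOfDelta {t | 0 ≤ t} δ) (Ici u) u := by
  set x := cdfOfDelta {t | 0 ≤ t} δ with hx
  have hx1 : x u ≤ 1 := h.cdfOfDelta_le_one_of_pos hu.1
  have hx0 : 0 ≤ x u := cdfOfDelta_nonneg_of_pos hu.1
  have hmem : Ico u 1 ∈ 𝓝[≥] u := Ico_mem_nhdsGE hu.2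
  refine tendsto_order.2 ⟨fun c hc => ?_, fun c hc => ?_⟩
  · filter_upwards [hmem] with v hv
    exact hc.trans_le
      (h.cdfOfDelta_monotoneOn_Ioc ⟨hu.1, hu.2.le⟩ ⟨hu.1.trans_le hv.1, hv.2.le⟩ hv.1)
  · have hm : u * x u < 1 := by nlinarith [hu.1, hu.2]
    -- A hyperbola of level m strictly above the point of the graph at u. The bound m < 1 makes its
    -- time -log m nonnegative. Lying above the graph means δ t < -log u, an open condition on u, so
    -- it persists nearby.
    obtain ⟨m, hm1, hm2⟩ := exists_between (lt_min (mul_lt_mul_of_pos_left hc hu.1) hm)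
    have hmpos : 0 < m := lt_of_le_of_lt (by positivity [hu.1]) hm1
    have hmlt := lt_min_iff.1 hm2
    set t := -Real.log m with ht
    have ht0 : 0 ≤ t := by linarith [Real.log_nonpos hmpos.le hmlt.2.le]
    have hte : Real.exp (-t) = m := by rw [ht, neg_neg, Real.exp_log hmpos]
    have hδ : δ t < -Real.log u := by
      by_contra! hle
      have := (h.exp_neg_le_mul_cdfOfDelta_iff hu.1 hu.2.le ht0).2 hle
      rw [hte] at this
      linarith
    have hcont : ContinuousAt (fun v => -Real.log v) u :=
      (Real.continuousAt_log hu.1.ne').neg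
    filter_upwards [hmem, nhdsWithin_le_nhds (hcont.eventually_const_lt hδ)] with v hv hδv
    have hv0 : 0 < v := hu.1.trans_le hv.1
    have hlt : v * x v < m := by
      by_contra! hle
      rw [← hte] at hle
      linarith [(h.exp_neg_le_mul_cdfOfDelta_iff hv0 hv.2.le ht0).1 hle]
    have : v * x v < v * c :=
      hlt.trans (hmlt.1.trans_le (mul_le_mul_of_nonneg_right hv.1 (hx0.trans hc.le)))
    exact lt_of_mul_lt_mul_left this hv0.le

/-- The value at 0 is a `limUnder`, meaningful only if the limit exists; it does, by monotonicity
and the lower bound 0. -/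
theorem cdfOfDelta_tendsto_zero (h : IsDeltaPath δ) :
    Tendsto (cdfOfDelta {t | 0 ≤ t} δ) (𝓝[>] 0) (𝓝 (cdfOfDelta {t | 0 ≤ t} δ 0)) := by
  have heq : cdfOfDeltaPos {t | 0 ≤ t} δ =ᶠ[𝓝[>] 0] cdfOfDelta {t | 0 ≤ t} δ := by
    filter_upwards [self_mem_nhdsWithin] with u hu
    rw [cdfOfDelta, if_pos (mem_Ioi.1 hu)]
  have h0 : cdfOfDelta {t | 0 ≤ t} δ 0
      = limUnder (𝓝[>] (0 : ℝ)) (cdfOfDelta {t | 0 ≤ t} δ) := by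
    rw [limUnder, ← Filter.map_congr heq, cdfOfDelta, if_neg (lt_irrefl 0), limUnder]
  rw [h0]
  refine tendsto_nhds_limUnder ?_
  have hmono : MonotoneOn (cdfOfDelta {t | 0 ≤ t} δ) (Ioo 0 1) :=
    h.cdfOfDelta_monotoneOn_Ioc.mono Ioo_subset_Ioc_self
  refine ⟨_, hmono.tendsto_nhdsWithin_Ioo_right (nonempty_Ioo.2 zero_lt_one) ⟨0, ?_⟩⟩
  rintro y ⟨u, hu, rfl⟩
  exact cdfOfDelta_nonneg_of_pos hu.1

theorem cdfOfDelta_zero_mem (h : IsDeltaPath δ) :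
    cdfOfDelta {t | 0 ≤ t} δ 0 ∈ Icc (0 : ℝ) 1 := by
  refine isClosed_Icc.mem_of_tendsto h.cdfOfDelta_tendsto_zero ?_
  filter_upwards [self_mem_nhdsWithin] with u hu
  exact ⟨cdfOfDelta_nonneg_of_pos hu, h.cdfOfDelta_le_one_of_pos hu⟩

theorem isCDF (h : IsDeltaPath δ) : IsCDF (cdfOfDelta {t | 0 ≤ t} δ) := by
  have hpos : ∀ u ∈ Ioc (0 : ℝ) 1,
      cdfOfDelta {t | 0 ≤ t} δ 0 ≤ cdfOfDelta {t | 0 ≤ t} δ u := fun u hu => by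
    refine le_of_tendsto h.cdfOfDelta_tendsto_zero ?_
    filter_upwards [Ioc_mem_nhdsGT hu.1] with v hv
    exact h.cdfOfDelta_monotoneOn_Ioc ⟨hv.1, hv.2.trans hu.2⟩ hu hv.2
  refine ⟨fun u hu => ?_, fun u hu v hv huv => ?_, fun u hu => ?_, ?_⟩
  · rcases hu.1.eq_or_lt with rfl | hu0
    · exact h.cdfOfDelta_zero_mem
    · exact ⟨cdfOfDelta_nonneg_of_pos hu0, h.cdfOfDelta_le_one_of_pos hu0⟩
  · rcases hu.1.eq_or_lt with rfl | hu0
    · rcases hv.1.eq_or_lt with rfl | hv0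
      · exact le_rfl
      · exact hpos v ⟨hv0, hv.2⟩
    · exact h.cdfOfDelta_monotoneOn_Ioc ⟨hu0, hu.2⟩ ⟨hu0.trans_le huv, hv.2⟩ huv
  · rcases hu.1.eq_or_lt with rfl | hu0
    · exact continuousWithinAt_Ioi_iff_Ici.1 h.cdfOfDelta_tendsto_zero
    · exact h.cdfOfDelta_rightCts_pos ⟨hu0, hu.2⟩
  · have := h.cdfOfDelta_exp le_rfl fun s hs hs' => absurd hs hs'.not_ge
    simpa [h.zero] using this

/-- By the hyperbola criterion, quantiles below e^{-δ t} satisfy u·x(u) ≤ e^{-t}, and larger ones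
violate it, so the supremum in `psiTransform` is e^{-δ t}. -/
theorem deltaTransform_cdfOfDelta (h : IsDeltaPath δ) {t : ℝ} (ht : 0 ≤ t) :
    deltaTransform (cdfOfDelta {t | 0 ≤ t} δ) t = δ t := by
  have hψ : psiTransform (cdfOfDelta {t | 0 ≤ t} δ) (Real.exp (-t)) = Real.exp (-δ t) := by
    have hle1 : Real.exp (-δ t) ≤ 1 := Real.exp_le_one_iff.2 (by linarith [h.nonneg ht])
    refine csSup_eq_of_forall_le_of_forall_lt_exists_gt
      ⟨0, ⟨le_rfl, zero_le_one⟩, by simpa using (Real.exp_pos _).le⟩ ?_ ?_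
    · rintro u ⟨hu, hux⟩
      by_contra! hlt
      have hu0 : 0 < u := (Real.exp_pos _).trans hlt
      have hs : -Real.log u < δ t := by
        have := (Real.lt_log_iff_exp_lt hu0).2 hlt
        linarith
      -- The criterion at t itself would give only a weak inequality. Going back by ε keeps the time
      -- nonnegative and, by the slope bound, keeps the path at or above -log u.
      set ε := min t (δ t + Real.log u) with hε
      have hδpos : 0 < δ t := by linarith [Real.log_nonpos hu0.le hu.2]
      have hε0 : 0 < ε := lt_min (hδpos.trans_le (h.le_self ht)) (by linarith)
      have h1 : ε ≤ t := min_le_left _ _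
      have h2 : ε ≤ δ t + Real.log u := min_le_right _ _
      have h3 := h.slope (t - ε) t (by linarith) (by linarith)
      have := (h.exp_neg_le_mul_cdfOfDelta_iff hu0 hu.2 (t := t - ε) (by linarith)).2
        (by linarith)
      have := Real.exp_lt_exp.2 (show -t < -(t - ε) by linarith)
      linarith
    · intro w hw
      obtain ⟨v, hv1, hv2⟩ := exists_between (max_lt hw (Real.exp_pos (-δ t)))
      have hv := max_lt_iff.1 hv1
      have hv1' : v ≤ 1 := hv2.le.trans hle1
      refine ⟨v, ⟨⟨hv.2.le, hv1'⟩, ?_⟩, hv.1⟩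
      by_contra! hlt
      have := (h.exp_neg_le_mul_cdfOfDelta_iff hv.2 hv1' ht).1 hlt.le
      have := (Real.log_lt_iff_lt_exp hv.2).2 hv2
      linarith
  rw [deltaTransform, hψ, Real.log_exp, neg_neg]

end IsDeltaPath

/-! ### The δ-transform of a distribution function -/

namespace IsCDF

variable {x : ℝ → ℝ}

theorem monotoneOn_mul (hx : IsCDF x) : MonotoneOn (fun u => u * x u) (Icc 0 1) :=
  fun u hu _ hv huv =>
    mul_le_mul huv (hx.2.1 hu hv huv) (hx.1 u hu).1 hv.1

theorem psiTransform_bddAbove (x : ℝ → ℝ) (ι : ℝ) :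
    BddAbove {u : ℝ | u ∈ Icc (0 : ℝ) 1 ∧ u * x u ≤ ι} :=
  ⟨1, fun _ hu => hu.1.2⟩

theorem psiTransform_le_one (x : ℝ → ℝ) (ι : ℝ) : psiTransform x ι ≤ 1 :=
  Real.sSup_le (fun _ hu => hu.1.2) zero_le_one

theorem le_psiTransform (hx : IsCDF x) {ι : ℝ} (h : ι ∈ Icc (0 : ℝ) 1) : ι ≤ psiTransform x ι :=
  le_csSup (psiTransform_bddAbove x ι) ⟨h, mul_le_of_le_one_right h.1 (hx.1 ι h).2⟩

theorem lt_mul_of_psiTransform_lt {ι u : ℝ} (hu : u ∈ Icc (0 : ℝ) 1) (h : psiTransform x ι < u) :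
    ι < u * x u := by
  by_contra! hle
  exact h.not_ge (le_csSup (psiTransform_bddAbove x ι) ⟨hu, hle⟩)

theorem mul_le_of_lt_psiTransform (hx : IsCDF x) {ι u : ℝ} (hι : ι ∈ Icc (0 : ℝ) 1)
    (hu : 0 ≤ u) (h : u < psiTransform x ι) : u * x u ≤ ι := by
  have hne : {u : ℝ | u ∈ Icc (0 : ℝ) 1 ∧ u * x u ≤ ι}.Nonempty :=
    ⟨ι, hι, mul_le_of_le_one_right hι.1 (hx.1 ι hι).2⟩
  obtain ⟨v, hv, huv⟩ := exists_lt_of_lt_csSup hne h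
  exact (hx.monotoneOn_mul ⟨hu, huv.le.trans hv.1.2⟩ hv.1 huv.le).trans hv.2

theorem exp_neg_mem {t : ℝ} (ht : 0 ≤ t) : Real.exp (-t) ∈ Icc (0 : ℝ) 1 :=
  ⟨(Real.exp_pos _).le, Real.exp_le_one_iff.2 (by linarith)⟩

/-- Since x ≤ 1, the ψ-transform at e^{-t} is at least e^{-t}, so the logarithm is taken at a
positive number. -/
theorem exp_neg_deltaTransform (hx : IsCDF x) {t : ℝ} (ht : 0 ≤ t) :
    Real.exp (-deltaTransform x t) = psiTransform x (Real.exp (-t)) := by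
  rw [deltaTransform, neg_neg, Real.exp_log]
  exact (Real.exp_pos _).trans_le (hx.le_psiTransform (exp_neg_mem ht))

theorem deltaTransform_mem (hx : IsCDF x) {t : ℝ} (ht : 0 ≤ t) :
    deltaTransform x t ∈ Icc 0 t := by
  have h := hx.exp_neg_deltaTransform ht
  constructor
  · have : Real.exp (-deltaTransform x t) ≤ 1 := h ▸ psiTransform_le_one _ _
    linarith [Real.exp_le_one_iff.1 this]
  · have : Real.exp (-t) ≤ Real.exp (-deltaTransform x t) :=
      h ▸ hx.le_psiTransform (exp_neg_mem ht)
    linarith [Real.exp_le_exp.1 this]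

/-- With `le_of_deltaTransform_lt`, this identifies the region below the graph on each hyperbola as
τ < δ(t), except at the single point τ = δ(t). -/
theorem lt_of_lt_deltaTransform (hx : IsCDF x) {t τ : ℝ} (ht : 0 ≤ t) (hτ : 0 ≤ τ)
    (h : τ < deltaTransform x t) : Real.exp (-t) < Real.exp (-τ) * x (Real.exp (-τ)) := by
  refine lt_mul_of_psiTransform_lt (exp_neg_mem hτ) ?_
  rw [← hx.exp_neg_deltaTransform ht]
  exact Real.exp_lt_exp.2 (neg_lt_neg h)

theorem le_of_deltaTransform_lt (hx : IsCDF x) {t τ : ℝ} (ht : 0 ≤ t)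
    (h : deltaTransform x t < τ) : Real.exp (-τ) * x (Real.exp (-τ)) ≤ Real.exp (-t) := by
  refine hx.mul_le_of_lt_psiTransform (exp_neg_mem ht) (Real.exp_pos _).le ?_
  rw [← hx.exp_neg_deltaTransform ht]
  exact Real.exp_lt_exp.2 (neg_lt_neg h)

/-- A monotone function on the line that extends a distribution function on the unit interval. -/
theorem exists_monotone (hx : IsCDF x) :
    ∃ X : ℝ → ℝ, Monotone X ∧ (∀ u, X u ≤ 1) ∧ ∀ u ∈ Icc (0 : ℝ) 1, X u = x u := by
  have hmono : Monotone fun u : Icc (0 : ℝ) 1 => x u := fun u v huv => hx.2.1 u.2 v.2 huv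
  exact ⟨IccExtend zero_le_one fun u : Icc (0 : ℝ) 1 => x u, hmono.comp (monotone_projIcc _),
    fun u => (hx.1 _ (projIcc 0 1 zero_le_one u).2).2, fun u hu => IccExtend_of_mem _ _ hu⟩

end IsCDF

/-! ### Change of variables for the area below a graph -/

theorem image_exp_sub_univ (τ : ℝ) : (fun t => Real.exp (τ - t)) '' univ = Ioi 0 := by
  ext y
  constructor
  · rintro ⟨t, -, rfl⟩
    exact Real.exp_pos _
  · intro hy
    exact ⟨τ - Real.log y, mem_univ _, by simp [Real.exp_log (mem_Ioi.1 hy)]⟩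

theorem image_exp_neg_Ioi : (fun t => Real.exp (-t)) '' Ioi 0 = Ioo 0 1 := by
  ext y
  constructor
  · rintro ⟨t, ht, rfl⟩
    exact ⟨Real.exp_pos _, Real.exp_lt_one_iff.2 (by linarith [mem_Ioi.1 ht])⟩
  · intro hy
    exact ⟨-Real.log y, by simpa using Real.log_neg hy.1 hy.2, by simp [Real.exp_log hy.1]⟩

theorem integral_exp_sub_mul (τ : ℝ) (k : ℝ → ℝ) :
    ∫ t, Real.exp (τ - t) * k (Real.exp (τ - t)) = ∫ y in Ioi 0, k y := by
  have hd : ∀ t ∈ univ, HasDerivWithinAt (fun t => Real.exp (τ - t)) (-Real.exp (τ - t)) univ t :=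
    fun t _ => by
      have := ((hasDerivAt_id t).const_sub τ).exp
      exact (this.congr_deriv (by simp)).hasDerivWithinAt
  have h := integral_image_eq_integral_abs_deriv_smul MeasurableSet.univ hd
    (fun a _ b _ hab => by simpa using hab) k
  rw [image_exp_sub_univ, setIntegral_univ] at h
  rw [h]
  exact integral_congr_ae (.of_forall fun t => by simp)

theorem integral_exp_neg_mul (k : ℝ → ℝ) :
    ∫ t in Ioi 0, Real.exp (-t) * k (Real.exp (-t)) = ∫ u in Ioo 0 1, k u := by
  have hd : ∀ t ∈ Ioi (0 : ℝ),
      HasDerivWithinAt (fun t => Real.exp (-t)) (-Real.exp (-t)) (Ioi 0) t :=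
    fun t _ => by
      have := ((hasDerivAt_id t).neg).exp
      simpa using this.hasDerivWithinAt
  have h := integral_image_eq_integral_abs_deriv_smul measurableSet_Ioi hd
    (fun a _ b _ hab => by simpa using hab) k
  rw [image_exp_neg_Ioi] at h
  rw [h]
  exact integral_congr_ae (.of_forall fun t => by simp)

/-- The area below the graph of a distribution function in the coordinates `u = exp (-τ)`,
`y = exp (τ - t)`. -/
theorem IsCDF.integral_below_graph {x : ℝ → ℝ} (hx : IsCDF x) {g : ℝ → ℝ → ℝ}
    (hg : Measurable (Function.uncurry g)) {M : ℝ} (hM : ∀ y u, |g y u| ≤ M) :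
    IntegrableOn (fun t => Real.exp (-t) *
      ∫ τ in (0 : ℝ)..deltaTransform x t, g (Real.exp (τ - t)) (Real.exp (-τ))) (Ioi 0) ∧
    ∫ u in (0 : ℝ)..1, ∫ y in (0 : ℝ)..x u, g y u = ∫ t in Ioi 0, Real.exp (-t) *
      ∫ τ in (0 : ℝ)..deltaTransform x t, g (Real.exp (τ - t)) (Real.exp (-τ)) := by
  -- The monotone extension makes the region measurable in the whole plane.
  obtain ⟨X, hX, hX1, hXx⟩ := hx.exists_monotone
  have hM0 : 0 ≤ M := (abs_nonneg _).trans (hM 0 0)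
  set P : Set (ℝ × ℝ) := {p | 0 < p.2} ∩ {p | Real.exp (p.2 - p.1) < X (Real.exp (-p.2))} with hP
  have hPm : MeasurableSet P :=
    (measurableSet_lt measurable_const measurable_snd).inter
      (measurableSet_lt (by fun_prop) (hX.measurable.comp (by fun_prop)))
  set k : ℝ × ℝ → ℝ :=
    P.indicator fun p => Real.exp (-p.1) * g (Real.exp (p.2 - p.1)) (Real.exp (-p.2)) with hk
  have hkm : Measurable k := by
    refine Measurable.indicator ?_ hPm
    have h1 : Measurable fun p : ℝ × ℝ => Real.exp (-p.1) := by fun_prop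
    have h2 : Measurable fun p : ℝ × ℝ => (Real.exp (p.2 - p.1), Real.exp (-p.2)) := by fun_prop
    exact h1.mul (hg.comp h2)
  have hPt : ∀ p ∈ P, p.2 < p.1 := fun p hp => by
    have := lt_of_lt_of_le hp.2 (hX1 _)
    linarith [Real.exp_lt_one_iff.1 this]
  have hint : Integrable k (volume.prod volume) := by
    -- On the region 0 < τ < t, so the Jacobian e^{-t} is at most e^{-t/2}·e^{-τ/2}, a product of
    -- integrable functions.
    have he : Integrable ((Ioi (0 : ℝ)).indicator fun t => Real.exp (-(1 / 2) * t)) :=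
      (integrable_indicator_iff measurableSet_Ioi).2
        (integrableOn_exp_mul_Ioi (by norm_num) 0)
    refine Integrable.mono' ((he.mul_prod he).const_mul M) hkm.aestronglyMeasurable
      (.of_forall fun p => ?_)
    rw [hk, Real.norm_eq_abs]
    by_cases hp : p ∈ P
    · have h2 : (0 : ℝ) < p.2 := hp.1
      have h21 := hPt p hp
      rw [indicator_of_mem hp, indicator_of_mem (mem_Ioi.2 (h2.trans h21)),
        indicator_of_mem (mem_Ioi.2 h2), abs_mul, abs_of_pos (Real.exp_pos _), mul_comm,
        ← Real.exp_add]
      refine mul_le_mul (hM _ _) (Real.exp_le_exp.2 (by linarith)) (Real.exp_pos _).le hM0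
    · rw [indicator_of_notMem hp, abs_zero]
      exact mul_nonneg hM0 (mul_nonneg (indicator_nonneg (fun _ _ => (Real.exp_pos _).le) _)
        (indicator_nonneg (fun _ _ => (Real.exp_pos _).le) _))
  have hC : ∀ t ∈ Ioi (0 : ℝ), ∫ τ, k (t, τ) = Real.exp (-t) *
      ∫ τ in (0 : ℝ)..deltaTransform x t, g (Real.exp (τ - t)) (Real.exp (-τ)) := by
    intro t ht
    have ht0 : 0 ≤ t := (mem_Ioi.1 ht).le
    have hδ := hx.deltaTransform_mem ht0
    rw [intervalIntegral.integral_of_le hδ.1, ← integral_const_mul, integral_Ioc_eq_integral_Ioo,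
      ← integral_indicator measurableSet_Ioo]
    refine integral_congr_ae ?_
    filter_upwards [compl_mem_ae_iff.2 (measure_singleton (deltaTransform x t))] with τ hτ
    have hτne : τ ≠ deltaTransform x t := hτ
    have hexp : Real.exp (-τ) * Real.exp (τ - t) = Real.exp (-t) := by
      rw [← Real.exp_add]; congr 1; ring
    by_cases hτ0 : 0 < τ
    · have hXe : X (Real.exp (-τ)) = x (Real.exp (-τ)) := hXx _ (IsCDF.exp_neg_mem hτ0.le)
      rcases lt_or_gt_of_ne hτne with hlt | hgt
      · have hmem : (t, τ) ∈ P := by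
          refine ⟨hτ0, ?_⟩
          have := hx.lt_of_lt_deltaTransform ht0 hτ0.le hlt
          rw [← hexp] at this
          simpa [hXe] using lt_of_mul_lt_mul_left this (Real.exp_pos _).le
        rw [hk, indicator_of_mem hmem, indicator_of_mem (mem_Ioo.2 ⟨hτ0, hlt⟩)]
      · have hmem : (t, τ) ∉ P := by
          rintro ⟨-, h⟩
          have := hx.le_of_deltaTransform_lt ht0 hgt
          simp only [mem_ofPred_eq, hXe] at h
          have := mul_lt_mul_of_pos_left h (Real.exp_pos (-τ))
          linarith
        rw [hk, indicator_of_notMem hmem, indicator_of_notMem fun h => hgt.not_gt h.2]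
    · have hmem : (t, τ) ∉ P := fun h => hτ0 h.1
      rw [hk, indicator_of_notMem hmem, indicator_of_notMem fun h => hτ0 h.1]
  have hC0 : ∀ t ∉ Ioi (0 : ℝ), ∫ τ, k (t, τ) = 0 := by
    intro t ht
    refine integral_eq_zero_of_ae (.of_forall fun τ => indicator_of_notMem (fun h => ht ?_) _)
    exact lt_trans h.1 (hPt _ h)
  have hA : ∀ τ ∈ Ioi (0 : ℝ), ∫ t, k (t, τ) = Real.exp (-τ) *
      ∫ y in (0 : ℝ)..x (Real.exp (-τ)), g y (Real.exp (-τ)) := by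
    intro τ hτ
    have hu := IsCDF.exp_neg_mem (mem_Ioi.1 hτ).le
    have hXe : X (Real.exp (-τ)) = x (Real.exp (-τ)) := hXx _ hu
    rw [intervalIntegral.integral_of_le (hx.1 _ hu).1, integral_Ioc_eq_integral_Ioo,
      ← Ioi_inter_Iio, ← setIntegral_indicator measurableSet_Iio, ← integral_exp_sub_mul τ,
      ← integral_const_mul]
    refine integral_congr_ae (.of_forall fun t => ?_)
    simp only [hk]
    rw [← mul_assoc, ← Real.exp_add]
    by_cases h : Real.exp (τ - t) < x (Real.exp (-τ))
    · have hmem : (t, τ) ∈ P := ⟨hτ, by simpa [hXe] using h⟩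
      rw [indicator_of_mem hmem, indicator_of_mem (mem_Iio.2 h)]
      congr 2
      ring
    · have hmem : (t, τ) ∉ P := fun hh => h (by simpa [hXe] using hh.2)
      rw [indicator_of_notMem hmem, indicator_of_notMem (by exact h), mul_zero]
  have hA0 : ∀ τ ∉ Ioi (0 : ℝ), ∫ t, k (t, τ) = 0 := fun τ hτ =>
    integral_eq_zero_of_ae (.of_forall fun t => indicator_of_notMem (fun h => hτ h.1) _)
  constructor
  · exact (hint.integral_prod_left.integrableOn (s := Ioi 0)).congr_fun hC measurableSet_Ioi
  · have hswap : ∫ t, ∫ τ, k (t, τ) = ∫ τ, ∫ t, k (t, τ) := integral_integral_swap hint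
    rw [← setIntegral_congr_fun measurableSet_Ioi hC,
      setIntegral_eq_integral_of_forall_compl_eq_zero hC0, hswap,
      ← setIntegral_eq_integral_of_forall_compl_eq_zero hA0,
      setIntegral_congr_fun measurableSet_Ioi hA,
      integral_exp_neg_mul (fun u => ∫ y in (0 : ℝ)..x u, g y u),
      intervalIntegral.integral_of_le zero_le_one, integral_Ioc_eq_integral_Ioo]

/-! ### Border's constraint in the transformed space -/

theorem IsCDF.intervalIntegrable {x : ℝ → ℝ} (hx : IsCDF x) {a b : ℝ} (ha : a ∈ Icc (0 : ℝ) 1)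
    (hb : b ∈ Icc (0 : ℝ) 1) : IntervalIntegrable x volume a b :=
  (hx.2.1.mono (ordConnected_Icc.uIcc_subset ha hb)).intervalIntegrable

theorem integral_indicator_Ioi {c a : ℝ} (hc : 0 ≤ c) (hca : c ≤ a) :
    ∫ y in (0 : ℝ)..a, (Ioi c).indicator (fun _ => (1 : ℝ)) y = a - c := by
  rw [intervalIntegral.integral_of_le (hc.trans hca), setIntegral_indicator measurableSet_Ioi,
    Ioc_inter_Ioi, max_eq_right hc]
  simp [hca]

/-- Both sides are the area between the graph and the hyperbola of level e^{-t}. In time coordinates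
this is the part s < t. In the original coordinates the graph exceeds the hyperbola exactly right of
ψ = e^{-δ(t)}, up to the endpoint, and integrating e^{-t}/u from ψ to 1 gives e^{-t}·δ(t). -/
theorem IsCDF.integral_exp_neg_mul_deltaTransform {x : ℝ → ℝ} (hx : IsCDF x) {t : ℝ}
    (ht : 0 ≤ t) :
    ∫ s in (0 : ℝ)..t, Real.exp (-s) * deltaTransform x s =
      (∫ u in (Real.exp (-deltaTransform x t))..1, x u) - Real.exp (-t) * deltaTransform x t := by
  set g : ℝ → ℝ → ℝ := fun y u =>
    {p : ℝ × ℝ | Real.exp (-t) < p.2 * p.1}.indicator (fun _ => (1 : ℝ)) (y, u) with hg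
  have hgm : Measurable (Function.uncurry g) :=
    measurable_const.indicator (measurableSet_lt measurable_const (by fun_prop))
  have hgM : ∀ y u, |g y u| ≤ 1 := fun y u => by
    simp only [hg, indicator]
    split_ifs <;> simp
  have hδ := hx.deltaTransform_mem ht
  set ψ := Real.exp (-deltaTransform x t) with hψ
  have hψmem : ψ ∈ Icc (0 : ℝ) 1 := exp_neg_mem hδ.1
  have hψ0 : 0 < ψ := Real.exp_pos _
  have hψψ := hx.exp_neg_deltaTransform ht
  have key := (hx.integral_below_graph hgm hgM).2
  have hr : ∫ s in Ioi 0, Real.exp (-s) *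
      ∫ τ in (0 : ℝ)..deltaTransform x s, g (Real.exp (τ - s)) (Real.exp (-τ)) =
      ∫ s in (0 : ℝ)..t, Real.exp (-s) * deltaTransform x s := by
    rw [intervalIntegral.integral_of_le ht, integral_Ioc_eq_integral_Ioo, ← Ioi_inter_Iio,
      ← setIntegral_indicator measurableSet_Iio]
    refine setIntegral_congr_fun measurableSet_Ioi fun s hs => ?_
    have : ∀ τ, g (Real.exp (τ - s)) (Real.exp (-τ)) = if s < t then 1 else 0 := fun τ => by
      simp only [hg, indicator, mem_ofPred_eq, ← Real.exp_add, Real.exp_lt_exp]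
      exact if_congr ⟨fun h => by linarith, fun h => by linarith⟩ rfl rfl
    simp only [this, indicator, mem_Iio, intervalIntegral.integral_const]
    split_ifs <;> simp
  have h1 : EqOn (fun u => ∫ y in (0 : ℝ)..x u, g y u) (fun _ => 0) (Ioo 0 ψ) := fun u hu => by
    have hu1 : u ∈ Icc (0 : ℝ) 1 := ⟨hu.1.le, hu.2.le.trans hψmem.2⟩
    refine (intervalIntegral.integral_congr fun y hy => ?_).trans
      intervalIntegral.integral_zero
    rw [uIcc_of_le (hx.1 u hu1).1] at hy
    refine indicator_of_notMem (fun h => ?_) _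
    have := hx.mul_le_of_lt_psiTransform (exp_neg_mem ht) hu.1.le (hψψ ▸ hu.2)
    have h' : Real.exp (-t) < u * y := h
    linarith [mul_le_mul_of_nonneg_left hy.2 hu.1.le]
  have h2 : EqOn (fun u => ∫ y in (0 : ℝ)..x u, g y u) (fun u => x u - Real.exp (-t) * u⁻¹)
      (Ioo ψ 1) := fun u hu => by
    have hu0 : 0 < u := hψ0.trans hu.1
    have hlt := lt_mul_of_psiTransform_lt (x := x) (ι := Real.exp (-t)) ⟨hu0.le, hu.2.le⟩
      (hψψ ▸ hu.1)
    have hge : ∀ y, g y u = (Ioi (Real.exp (-t) * u⁻¹)).indicator (fun _ => (1 : ℝ)) y := by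
      intro y
      simp only [hg, indicator, mem_ofPred_eq, mem_Ioi]
      refine if_congr ?_ rfl rfl
      rw [← div_eq_mul_inv, div_lt_iff₀ hu0, mul_comm]
    simp only [hge]
    refine integral_indicator_Ioi (by positivity) ?_
    rw [← div_eq_mul_inv, div_le_iff₀ hu0, mul_comm]
    exact hlt.le
  have i1 : IntervalIntegrable (fun u => ∫ y in (0 : ℝ)..x u, g y u) volume 0 ψ := by
    rw [intervalIntegrable_iff_integrableOn_Ioo_of_le hψ0.le]
    exact integrableOn_zero.congr_fun h1.symm measurableSet_Ioo
  have hinv : IntervalIntegrable (fun u : ℝ => Real.exp (-t) * u⁻¹) volume ψ 1 := by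
    refine ContinuousOn.intervalIntegrable ?_
    rw [uIcc_of_le hψmem.2]
    exact continuousOn_const.mul (continuousOn_id.inv₀ fun u hu => (hψ0.trans_le hu.1).ne')
  have hxint := hx.intervalIntegrable hψmem (right_mem_Icc.2 zero_le_one)
  have i2 : IntervalIntegrable (fun u => ∫ y in (0 : ℝ)..x u, g y u) volume ψ 1 := by
    rw [intervalIntegrable_iff_integrableOn_Ioo_of_le hψmem.2]
    refine IntegrableOn.congr_fun ?_ h2.symm measurableSet_Ioo
    exact (intervalIntegrable_iff_integrableOn_Ioo_of_le hψmem.2).1 (hxint.sub hinv)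
  have e1 : ∫ u in (0 : ℝ)..ψ, ∫ y in (0 : ℝ)..x u, g y u = 0 := by
    rw [intervalIntegral.integral_of_le hψ0.le, integral_Ioc_eq_integral_Ioo,
      setIntegral_congr_fun measurableSet_Ioo h1, integral_zero]
  have e2 : ∫ u in ψ..1, ∫ y in (0 : ℝ)..x u, g y u =
      (∫ u in ψ..1, x u) - Real.exp (-t) * deltaTransform x t := by
    have : ∫ u in ψ..1, ∫ y in (0 : ℝ)..x u, g y u =
        ∫ u in ψ..1, (x u - Real.exp (-t) * u⁻¹) := by
      rw [intervalIntegral.integral_of_le hψmem.2, intervalIntegral.integral_of_le hψmem.2,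
        integral_Ioc_eq_integral_Ioo, integral_Ioc_eq_integral_Ioo,
        setIntegral_congr_fun measurableSet_Ioo h2]
    rw [this, intervalIntegral.integral_sub hxint hinv, intervalIntegral.integral_const_mul,
      integral_inv_of_pos hψ0 one_pos, one_div, Real.log_inv, hψ, Real.log_exp, neg_neg]
  rw [← hr, ← key, ← intervalIntegral.integral_add_adjacent_intervals i1 i2, e1, e2, zero_add]

theorem integral_exp_neg_mul_self (t : ℝ) :
    ∫ s in (0 : ℝ)..t, Real.exp (-s) * s = 1 - Real.exp (-t) * (1 + t) := by
  have hd : ∀ s ∈ uIcc 0 t, HasDerivAt (fun s => -(Real.exp (-s) * (1 + s)))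
      (Real.exp (-s) * s) s := fun s _ => by
    have h1 : HasDerivAt (fun s => Real.exp (-s)) (-Real.exp (-s)) s := by
      simpa using (hasDerivAt_id s).neg.exp
    have h2 : HasDerivAt (fun s : ℝ => 1 + s) 1 s := (hasDerivAt_id s).const_add 1
    exact (h1.mul h2).neg.congr_deriv (by ring)
  rw [intervalIntegral.integral_eq_sub_of_hasDerivAt hd
    (Continuous.intervalIntegrable (by fun_prop) _ _)]
  simp only [neg_zero, Real.exp_zero]
  ring

theorem IsCDF.integrableOn_exp_neg_mul_deltaTransform {x : ℝ → ℝ} (hx : IsCDF x) :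
    IntegrableOn (fun t => Real.exp (-t) * deltaTransform x t) (Ioi 0) := by
  have := (hx.integral_below_graph (g := fun _ _ => 1) measurable_const (M := 1) (by simp)).1
  simpa using this

theorem integrableOn_exp_neg_mul_self :
    IntegrableOn (fun t : ℝ => Real.exp (-t) * t) (Ioi 0) := by
  have := Real.GammaIntegral_convergent (s := 2) two_pos
  refine this.congr_fun (fun t _ => ?_) measurableSet_Ioi
  norm_num

/-- Border's constraint in the transformed space. -/
theorem IsFeasible.integral_exp_neg_mul_sub_nonpos {n : ℕ} {x : Fin n → ℝ → ℝ}
    (hx : IsFeasible x) {t : ℝ} (ht : 0 ≤ t) :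
    ∫ s in (0 : ℝ)..t, Real.exp (-s) * (∑ i, deltaTransform (x i) s - s) ≤ 0 := by
  have hint : ∀ i, IntervalIntegrable (fun s => Real.exp (-s) * deltaTransform (x i) s)
      volume 0 t := fun i => by
    rw [intervalIntegrable_iff_integrableOn_Ioc_of_le ht]
    exact (hx.1 i).integrableOn_exp_neg_mul_deltaTransform.mono_set Ioc_subset_Ioi_self
  have hsum : IntervalIntegrable (fun s => ∑ i, Real.exp (-s) * deltaTransform (x i) s)
      volume 0 t := by
    have := IntervalIntegrable.sum (μ := volume) (a := 0) (b := t) Finset.univ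
      (f := fun i s => Real.exp (-s) * deltaTransform (x i) s) fun i _ => hint i
    refine this.congr (fun s _ => ?_)
    simp
  have hself : IntervalIntegrable (fun s : ℝ => Real.exp (-s) * s) volume 0 t :=
    Continuous.intervalIntegrable (by fun_prop) _ _
  have hB := hx.2 (fun i => Real.exp (-deltaTransform (x i) t))
    fun i => IsCDF.exp_neg_mem ((hx.1 i).deltaTransform_mem ht).1
  rw [borderValue, ← Real.exp_sum, Finset.sum_neg_distrib] at hB
  simp only [mul_sub, Finset.mul_sum]
  rw [intervalIntegral.integral_sub hsum hself,
    intervalIntegral.integral_finsetSum fun i _ => hint i, integral_exp_neg_mul_self]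
  simp only [fun i => (hx.1 i).integral_exp_neg_mul_deltaTransform ht]
  rw [Finset.sum_sub_distrib, ← Finset.mul_sum]
  set D := ∑ i, deltaTransform (x i) t
  -- The product in Border's constraint is e^{-D}; bounding it below by its tangent at D = t yields
  -- a constraint affine in the transforms.
  have hexp : Real.exp (-t) * (1 + (t - D)) ≤ Real.exp (-D) := by
    have h1 := Real.add_one_le_exp (t - D)
    have h2 : Real.exp (-D) = Real.exp (-t) * Real.exp (t - D) := by
      rw [← Real.exp_add]; congr 1; ring
    rw [h2]
    exact mul_le_mul_of_nonneg_left (by linarith) (Real.exp_pos _).le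
  linarith

/-- A nonincreasing nonnegative weight preserves the sign of nonpositive partial integrals. -/
theorem integral_antitone_mul_nonpos {h φ : ℝ → ℝ} (hh : IntegrableOn h (Ioi 0))
    (hφ : Antitone φ) (hφ0 : ∀ t, 0 ≤ φ t) {M : ℝ} (hφM : ∀ t, φ t ≤ M)
    (hneg : ∀ t, 0 ≤ t → ∫ s in (0 : ℝ)..t, h s ≤ 0) :
    ∫ t in Ioi 0, φ t * h t ≤ 0 := by
  -- Layer-cake representation: φ t is the integral over levels c of the indicator of c < φ t. Each
  -- superlevel set is an initial segment, on which the integral of `h` is nonpositive by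
  -- assumption.
  set k : ℝ × ℝ → ℝ := {p : ℝ × ℝ | p.2 < φ p.1}.indicator fun p => h p.1 with hk
  have hkint : Integrable k ((volume.restrict (Ioi 0)).prod (volume.restrict (Ioo 0 M))) := by
    have h1 : Integrable (fun p : ℝ × ℝ => h p.1 * 1)
        ((volume.restrict (Ioi 0)).prod (volume.restrict (Ioo 0 M))) :=
      Integrable.mul_prod (f := h) (g := fun _ => (1 : ℝ)) hh (integrable_const _)
    simp only [mul_one] at h1
    exact h1.indicator (measurableSet_lt measurable_snd (hφ.measurable.comp measurable_fst))
  have hinner : ∀ t, φ t * h t = ∫ c in Ioo 0 M, k (t, c) := fun t => by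
    have : ∀ c, k (t, c) = (Iio (φ t)).indicator (fun _ => h t) c := fun c => by
      simp [hk, indicator]
    simp only [this]
    rw [setIntegral_indicator measurableSet_Iio, Ioo_inter_Iio, min_eq_right (hφM t)]
    simp [hφ0 t]
  simp only [hinner]
  rw [integral_integral_swap (f := fun t c => k (t, c)) hkint]
  refine integral_nonpos fun c => ?_
  have hslice : ∫ t in Ioi 0, k (t, c) = ∫ t in Ioi 0 ∩ {t | c < φ t}, h t := by
    rw [← setIntegral_indicator (measurableSet_lt measurable_const hφ.measurable)]
    rfl
  simp only [Pi.zero_apply, hslice]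
  by_cases hall : ∀ t, 0 < t → c < φ t
  · rw [inter_eq_left.2 (show Ioi 0 ⊆ {t | c < φ t} from fun t ht => hall t ht)]
    refine le_of_tendsto (intervalIntegral_tendsto_integral_Ioi 0 hh tendsto_id) ?_
    filter_upwards [eventually_ge_atTop 0] with t ht using hneg t ht
  · push Not at hall
    obtain ⟨b, hb, hbc⟩ := hall
    set S := Ioi 0 ∩ {t | c < φ t} with hS
    have hbdd : BddAbove S := ⟨b, fun t ht => by
      by_contra! hbt
      exact absurd (hφ hbt.le) (by linarith [show c < φ t from ht.2])⟩
    have ha : 0 ≤ sSup S := Real.sSup_nonneg fun t ht => (mem_Ioi.1 ht.1).le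
    have hsub1 : S ⊆ Ioc 0 (sSup S) := fun t ht => ⟨ht.1, le_csSup hbdd ht⟩
    have hsub2 : Ioo 0 (sSup S) ⊆ S := fun t ht => by
      have hne : S.Nonempty := by
        by_contra! h
        rw [h, Real.sSup_empty] at ht
        exact lt_asymm ht.1 ht.2
      obtain ⟨v, hv, htv⟩ := exists_lt_of_lt_csSup hne ht.2
      exact ⟨ht.1, lt_of_lt_of_le hv.2 (hφ htv.le)⟩
    -- φ may jump, so the segment may or may not contain its right end.
    have hae : S =ᵐ[volume] Ioc 0 (sSup S) :=
      (LE.le.eventuallyLE hsub1).antisymm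
        (Ioo_ae_eq_Ioc.symm.le.trans (LE.le.eventuallyLE hsub2))
    rw [setIntegral_congr_set hae, ← intervalIntegral.integral_of_le ha]
    exact hneg _ ha

theorem measurable_indicator_of_domRestrict {α : Type*} [MeasurableSpace α] {f : α → ℝ}
    {s : Set α} (hf : Measurable (s.domRestrict f)) (hs : MeasurableSet s) :
    Measurable (s.indicator f) := by
  refine measurable_of_restrict_of_restrict_compl hs ?_ ?_
  · convert hf using 1
    funext a
    exact indicator_of_mem a.2 f
  · convert (measurable_const : Measurable fun _ : (sᶜ : Set α) => (0 : ℝ)) using 1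
    funext a
    exact indicator_of_notMem a.2 f

/-! ### Revenue in the transformed space and sufficiency of first-order conditions -/

namespace AuctionEnv

variable {n : ℕ} (E : AuctionEnv n)

theorem H_continuousOn (i : Fin n) :
    ContinuousOn (fun p : ℝ × ℝ => E.H i p.1 p.2) (Icc (0 : ℝ) 1 ×ˢ Icc (0 : ℝ) 1) :=
  (E.J_contDiff i).continuousOn.comp
    (continuousOn_fst.prodMk ((E.quantile_continuousOn i).comp continuousOn_snd fun _ hp => hp.2))
    fun p hp => (⟨hp.1, E.quantile_mem i hp.2⟩ :
      ((p.1, E.quantile i p.2) : ℝ × ℝ) ∈ Icc (0 : ℝ) 1 ×ˢ Icc (E.lo i) (E.hi i))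

theorem hasDerivWithinAt_H (i : Fin n) {x u : ℝ} (hx : x ∈ Icc (0 : ℝ) 1)
    (hu : u ∈ Icc (0 : ℝ) 1) :
    HasDerivWithinAt (fun y => E.H i y u) (E.dH i x u) (Icc 0 1) x := by
  have hd := ((E.J_contDiff i).differentiableOn (by norm_num)) (x, E.quantile i u)
    ⟨hx, E.quantile_mem i hu⟩
  have hl : DifferentiableWithinAt ℝ (fun y : ℝ => (y, E.quantile i u)) (Icc 0 1) x :=
    differentiableWithinAt_id.prodMk (differentiableWithinAt_const _)
  have hm : MapsTo (fun y : ℝ => (y, E.quantile i u)) (Icc 0 1)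
      (Icc (0 : ℝ) 1 ×ˢ Icc (E.lo i) (E.hi i)) := fun y hy => ⟨hy, E.quantile_mem i hu⟩
  exact (hd.comp x hl hm).hasDerivWithinAt

theorem H_sub_H_zero (i : Fin n) {x u : ℝ} (hx : x ∈ Icc (0 : ℝ) 1) (hu : u ∈ Icc (0 : ℝ) 1) :
    E.H i x u - E.H i 0 u = ∫ y in (0 : ℝ)..x, E.dH i y u := by
  have hsub : Icc 0 x ⊆ Icc (0 : ℝ) 1 := Icc_subset_Icc_right hx.2
  refine (intervalIntegral.integral_eq_sub_of_hasDerivAt_of_le hx.1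
    (fun y hy => ((E.hasDerivWithinAt_H i (hsub hy) hu).continuousWithinAt).mono hsub)
    (fun y hy => (E.hasDerivWithinAt_H i (hsub (Ioo_subset_Icc_self hy)) hu).hasDerivAt
      (Icc_mem_nhds hy.1 (hy.2.trans_le hx.2))) ?_).symm
  refine ContinuousOn.intervalIntegrable ?_
  rw [uIcc_of_le hx.1]
  exact (E.dH_continuousOn i).comp (f := fun y : ℝ => (y, u)) (by fun_prop)
    fun y hy => ⟨hsub hy, hu⟩

theorem exists_abs_dH_le (i : Fin n) :
    ∃ M, ∀ x ∈ Icc (0 : ℝ) 1, ∀ u ∈ Icc (0 : ℝ) 1, |E.dH i x u| ≤ M := by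
  obtain ⟨M, hM⟩ := (isCompact_Icc.prod isCompact_Icc).exists_bound_of_continuousOn
    (E.dH_continuousOn i)
  exact ⟨M, fun x hx u hu => hM (x, u) ⟨hx, hu⟩⟩

theorem intervalIntegrable_H (i : Fin n) {x : ℝ → ℝ} (hx : MonotoneOn x (Icc 0 1))
    (hx1 : ∀ u ∈ Icc (0 : ℝ) 1, x u ∈ Icc (0 : ℝ) 1) :
    IntervalIntegrable (fun u => E.H i (x u) u) volume 0 1 := by
  obtain ⟨M, hM⟩ := (isCompact_Icc.prod isCompact_Icc).exists_bound_of_continuousOn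
    (E.H_continuousOn i)
  have hmeas : Measurable ((Icc (0 : ℝ) 1 ×ˢ Icc (0 : ℝ) 1).indicator
      fun p : ℝ × ℝ => E.H i p.1 p.2) :=
    measurable_indicator_of_domRestrict (E.H_continuousOn i).domRestrict.measurable
      (measurableSet_Icc.prod measurableSet_Icc)
  rw [intervalIntegrable_iff_integrableOn_Icc_of_le zero_le_one]
  have haem : AEMeasurable (fun u => (x u, u)) (volume.restrict (Icc (0 : ℝ) 1)) :=
    (aemeasurable_restrict_of_monotoneOn measurableSet_Icc hx).prodMk aemeasurable_id
  refine IntegrableOn.of_bound (by simp) ?_ M ?_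
  · refine (hmeas.comp_aemeasurable haem).aestronglyMeasurable.congr ?_
    filter_upwards [ae_restrict_mem measurableSet_Icc] with u hu
    exact indicator_of_mem (show (x u, u) ∈ Icc (0 : ℝ) 1 ×ˢ Icc (0 : ℝ) 1 from ⟨hx1 u hu, hu⟩) _
  · filter_upwards [ae_restrict_mem measurableSet_Icc] with u hu
    exact hM (x u, u) ⟨hx1 u hu, hu⟩

/-- Revenue as an integral over the times of the transformed reduced form. -/
theorem integral_H_eq (i : Fin n) {x : ℝ → ℝ} (hx : IsCDF x) :
    IntegrableOn (fun t => Real.exp (-t) * E.R i (deltaTransform x t) t) (Ioi 0) ∧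
    ∫ u in (0 : ℝ)..1, E.H i (x u) u = (∫ u in (0 : ℝ)..1, E.H i 0 u) +
      ∫ t in Ioi 0, Real.exp (-t) * E.R i (deltaTransform x t) t := by
  obtain ⟨M, hM⟩ := E.exists_abs_dH_le i
  have hM0 : 0 ≤ M := (abs_nonneg _).trans
    (hM 0 (left_mem_Icc.2 zero_le_one) 0 (left_mem_Icc.2 zero_le_one))
  -- Marginal revenue extended by zero off the unit square, since the area formula asks for a
  -- globally measurable bounded integrand.
  set g : ℝ → ℝ → ℝ := fun y u =>
    (Icc (0 : ℝ) 1 ×ˢ Icc (0 : ℝ) 1).indicator (fun p : ℝ × ℝ => E.dH i p.1 p.2) (y, u) with hg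
  have hgm : Measurable (Function.uncurry g) := by
    change Measurable ((Icc (0 : ℝ) 1 ×ˢ Icc (0 : ℝ) 1).indicator
      fun p : ℝ × ℝ => E.dH i p.1 p.2)
    exact measurable_indicator_of_domRestrict (E.dH_continuousOn i).domRestrict.measurable
      (measurableSet_Icc.prod measurableSet_Icc)
  have hge : ∀ y ∈ Icc (0 : ℝ) 1, ∀ u ∈ Icc (0 : ℝ) 1, g y u = E.dH i y u := fun y hy u hu =>
    indicator_of_mem (show (y, u) ∈ Icc (0 : ℝ) 1 ×ˢ Icc (0 : ℝ) 1 from ⟨hy, hu⟩) _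
  have hgM : ∀ y u, |g y u| ≤ M := fun y u => by
    by_cases h : (y, u) ∈ Icc (0 : ℝ) 1 ×ˢ Icc (0 : ℝ) 1
    · rw [hge y h.1 u h.2]
      exact hM y h.1 u h.2
    · simp only [hg, indicator_of_notMem h, abs_zero, hM0]
  obtain ⟨hint, heq⟩ := hx.integral_below_graph hgm hgM
  have hR : EqOn (fun t => Real.exp (-t) *
      ∫ τ in (0 : ℝ)..deltaTransform x t, g (Real.exp (τ - t)) (Real.exp (-τ)))
      (fun t => Real.exp (-t) * E.R i (deltaTransform x t) t) (Ioi 0) := fun t ht => by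
    have hδ := hx.deltaTransform_mem (mem_Ioi.1 ht).le
    refine congrArg _ (intervalIntegral.integral_congr fun τ hτ => ?_)
    rw [uIcc_of_le hδ.1] at hτ
    refine hge _ ⟨(Real.exp_pos _).le, Real.exp_le_one_iff.2 ?_⟩ _ (IsCDF.exp_neg_mem hτ.1)
    linarith [hτ.2, hδ.2]
  refine ⟨hint.congr_fun hR measurableSet_Ioi, ?_⟩
  have h0 : IntervalIntegrable (fun u => E.H i 0 u) volume 0 1 :=
    E.intervalIntegrable_H i monotoneOn_const fun _ _ => left_mem_Icc.2 zero_le_one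
  rw [← setIntegral_congr_fun measurableSet_Ioi hR, ← heq, ← sub_eq_iff_eq_add',
    ← intervalIntegral.integral_sub (E.intervalIntegrable_H i hx.2.1 hx.1) h0]
  refine intervalIntegral.integral_congr fun u hu => ?_
  rw [uIcc_of_le zero_le_one] at hu
  simp only [E.H_sub_H_zero i (hx.1 u hu) hu]
  refine intervalIntegral.integral_congr fun y hy => ?_
  rw [uIcc_of_le (hx.1 u hu).1] at hy
  exact (hge y ⟨hy.1, hy.2.trans (hx.1 u hu).2⟩ u hu).symm

variable {E}

theorem IsRegular.marginalRevenue_strictAntiOn (hE : E.IsRegular) (i : Fin n) {t : ℝ}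
    (ht : 0 ≤ t) : StrictAntiOn (fun δ => E.marginalRevenue i δ t) (Icc 0 t) := by
  have hc := hE.concave i t ht
  intro a ha b hb hab
  have h1 := hc.slope_lt_of_hasDerivWithinAt ha hb hab (E.hasDerivWithinAt_R i ha)
  have h2 := hc.lt_slope_of_hasDerivWithinAt ha hb hab (E.hasDerivWithinAt_R i hb)
  exact h2.trans h1

theorem IsRegular.R_le_tangent (hE : E.IsRegular) (i : Fin n) {t a b : ℝ}
    (ha : a ∈ Icc 0 t) (hb : b ∈ Icc 0 t) :
    E.R i b t ≤ E.R i a t + E.marginalRevenue i a t * (b - a) := by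
  have hc := (hE.concave i t (ha.1.trans ha.2)).concaveOn
  rcases lt_trichotomy a b with hab | rfl | hab
  · have h1 := hc.slope_le_of_hasDerivWithinAt ha hb hab (E.hasDerivWithinAt_R i ha)
    rw [slope_def_field, div_le_iff₀ (by linarith)] at h1
    linarith
  · simp
  · have h1 := hc.le_slope_of_hasDerivWithinAt hb ha hab (E.hasDerivWithinAt_R i ha)
    rw [slope_def_field, le_div_iff₀ (by linarith)] at h1
    linarith

/-- A feasible reduced form is optimal if its transform satisfies the first-order conditions with
a nonincreasing multiplier for Border's constraint. -/
theorem IsRegular.isOptimal_of_multiplier (hE : E.IsRegular) {x : Fin n → ℝ → ℝ}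
    (hx : IsFeasible x) {φ : ℝ → ℝ} (hφ : Antitone φ) (hφ0 : ∀ t, 0 ≤ φ t) {M : ℝ}
    (hφM : ∀ t, φ t ≤ M)
    (hfoc : ∀ i t, 0 < t → E.marginalRevenue i (deltaTransform (x i) t) t = φ t)
    (hslack : ∀ t, 0 < t → φ t * (∑ i, deltaTransform (x i) t - t) = 0) :
    E.IsOptimal x := by
  refine ⟨hx, fun y hy => ?_⟩
  have hh : IntegrableOn (fun t => Real.exp (-t) * (∑ i, deltaTransform (y i) t - t)) (Ioi 0) := by
    simp only [mul_sub, Finset.mul_sum]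
    exact (integrable_finsetSum _ fun i _ =>
      (hy.1 i).integrableOn_exp_neg_mul_deltaTransform).sub integrableOn_exp_neg_mul_self
  have hneg := integral_antitone_mul_nonpos hh hφ hφ0 hφM
    fun t ht => hy.integral_exp_neg_mul_sub_nonpos ht
  have hφh : IntegrableOn (fun t => φ t * (Real.exp (-t) *
      (∑ i, deltaTransform (y i) t - t))) (Ioi 0) := by
    refine Integrable.mono' (hh.norm.const_mul M)
      (hφ.measurable.aestronglyMeasurable.mul hh.aestronglyMeasurable) (.of_forall fun t => ?_)
    rw [norm_mul, Real.norm_of_nonneg (hφ0 t)]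
    exact mul_le_mul_of_nonneg_right (hφM t) (norm_nonneg _)
  have hsum : ∀ z : Fin n → ℝ → ℝ, (∀ i, IsCDF (z i)) →
      IntegrableOn (fun t => ∑ i, Real.exp (-t) * E.R i (deltaTransform (z i) t) t) (Ioi 0) ∧
      E.revenue z = (∑ i, ∫ u in (0 : ℝ)..1, E.H i 0 u) +
        ∫ t in Ioi 0, ∑ i, Real.exp (-t) * E.R i (deltaTransform (z i) t) t := fun z hz => by
    refine ⟨integrable_finsetSum _ fun i _ => (E.integral_H_eq i (hz i)).1, ?_⟩
    rw [integral_finsetSum _ fun i _ => (E.integral_H_eq i (hz i)).1, ← Finset.sum_add_distrib]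
    exact Finset.sum_congr rfl fun i _ => (E.integral_H_eq i (hz i)).2
  obtain ⟨hyint, hyrev⟩ := hsum y hy.1
  obtain ⟨hxint, hxrev⟩ := hsum x hx.1
  -- Pointwise Lagrangian bound: the tangent inequality gives the error term φ·(∑ δ_y - ∑ δ_x), and
  -- complementary slackness replaces ∑ δ_x by t. The resulting penalty integrates to a nonpositive
  -- number by `hneg`.
  have hle : ∫ t in Ioi 0, ∑ i, Real.exp (-t) * E.R i (deltaTransform (y i) t) t ≤
      ∫ t in Ioi 0, (∑ i, Real.exp (-t) * E.R i (deltaTransform (x i) t) t +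
        φ t * (Real.exp (-t) * (∑ i, deltaTransform (y i) t - t))) := by
    refine setIntegral_mono_on hyint (hxint.add hφh) measurableSet_Ioi fun t ht => ?_
    have ht0 : 0 < t := ht
    have hi : ∀ i, E.R i (deltaTransform (y i) t) t ≤ E.R i (deltaTransform (x i) t) t +
        φ t * (deltaTransform (y i) t - deltaTransform (x i) t) := fun i => by
      have := hE.R_le_tangent i ((hx.1 i).deltaTransform_mem ht0.le)
        ((hy.1 i).deltaTransform_mem ht0.le)
      rwa [hfoc i t ht0] at this
    have hs := Finset.sum_le_sum fun i (_ : i ∈ Finset.univ) => hi i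
    rw [Finset.sum_add_distrib, ← Finset.mul_sum, Finset.sum_sub_distrib] at hs
    have := hslack t ht0
    rw [← Finset.mul_sum, ← Finset.mul_sum]
    have h2 := mul_le_mul_of_nonneg_left hs (Real.exp_pos (-t)).le
    have h3 : φ t * (∑ i, deltaTransform (y i) t - ∑ i, deltaTransform (x i) t) =
      φ t * (∑ i, deltaTransform (y i) t - t) := by linarith
    rw [h3] at h2
    linarith
  rw [integral_add hxint hφh] at hle
  rw [hyrev, hxrev]
  linarith

end AuctionEnv

/-! ### Allocations and the necessity of Border's constraint -/

/-- The uniform distribution on the unit interval. -/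
noncomputable abbrev uniformUnit : Measure ℝ := volume.restrict (Icc 0 1)

instance : IsProbabilityMeasure uniformUnit := ⟨by simp⟩

theorem volume_restrict_cube (n : ℕ) :
    (volume : Measure (Fin n → ℝ)).restrict (Icc 0 1) = Measure.pi fun _ => uniformUnit := by
  rw [volume_pi, ← pi_univ_Icc, Measure.restrict_pi_pi]
  rfl

instance (n : ℕ) : IsProbabilityMeasure ((volume : Measure (Fin n → ℝ)).restrict (Icc 0 1)) := by
  rw [volume_restrict_cube]
  infer_instance

/-- Redrawing one coordinate preserves a power of a probability measure. -/
theorem measurePreserving_update {ι α : Type*} [Fintype ι] [DecidableEq ι] [MeasurableSpace α]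
    (ν : Measure α) [IsProbabilityMeasure ν] (i : ι) :
    MeasurePreserving (fun p : α × (ι → α) => Function.update p.2 i p.1)
      (ν.prod (Measure.pi fun _ => ν)) (Measure.pi fun _ => ν) := by
  have hm : Measurable fun p : α × (ι → α) => Function.update p.2 i p.1 :=
    measurable_update'.comp measurable_swap
  refine ⟨hm, (Measure.pi_eq fun s hs => ?_).symm⟩
  have hpre : (fun p : α × (ι → α) => Function.update p.2 i p.1) ⁻¹' univ.pi s =
      s i ×ˢ univ.pi (Function.update s i univ) := by
    ext p
    simp only [mem_preimage, Set.mem_pi, mem_univ, forall_const, mem_prod]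
    constructor
    · intro h
      refine ⟨by simpa using h i, fun j => ?_⟩
      by_cases hj : j = i
      · subst hj; simp
      · simpa [hj] using h j
    · rintro ⟨h1, h2⟩ j
      by_cases hj : j = i
      · subst hj; simpa using h1
      · simpa [hj] using h2 j
  rw [Measure.map_apply hm (MeasurableSet.univ_pi hs), hpre, Measure.prod_prod, Measure.pi_pi,
    ← Finset.mul_prod_erase _ _ (Finset.mem_univ i), Function.update_self, measure_univ, one_mul,
    ← Finset.mul_prod_erase _ (fun j => ν (s j)) (Finset.mem_univ i)]
  refine congrArg _ (Finset.prod_congr rfl fun j hj => ?_)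
  rw [Function.update_of_ne (Finset.ne_of_mem_erase hj)]

/-- `interim` overwrites one coordinate; redrawing that coordinate independently leaves the uniform
law unchanged, so Fubini turns interim probabilities into integrals over the cube. -/
theorem integral_interim {n : ℕ} {z : (Fin n → ℝ) → Fin n → ℝ} (i : Fin n) {s : Set ℝ}
    (hs : MeasurableSet s) (hz : IntegrableOn (fun v => z v i) (Icc 0 1)) :
    ∫ u in Icc 0 1, s.indicator (interim z i) u =
      ∫ v in Icc 0 1, {v : Fin n → ℝ | v i ∈ s}.indicator (fun v => z v i) v := by
  have hs' : MeasurableSet {v : Fin n → ℝ | v i ∈ s} := (measurable_pi_apply i) hs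
  have hF : Integrable ({v : Fin n → ℝ | v i ∈ s}.indicator (fun v => z v i))
      (Measure.pi fun _ => uniformUnit) := by
    rw [← volume_restrict_cube]
    exact Integrable.indicator hz hs'
  have hmp := measurePreserving_update uniformUnit i
  rw [volume_restrict_cube, ← hmp.map_eq, integral_map hmp.aemeasurable
    (by rw [hmp.map_eq]; exact hF.aestronglyMeasurable), integral_prod]
  · refine integral_congr_ae (.of_forall fun u => ?_)
    by_cases hu : u ∈ s
    · simp only [indicator_of_mem hu]
      rw [interim, volume_restrict_cube]
      refine integral_congr_ae (.of_forall fun v => ?_)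
      have hmem : Function.update v i u ∈ {v : Fin n → ℝ | v i ∈ s} := by simpa using hu
      simp only [indicator_of_mem hmem]
    · simp only [indicator_of_notMem hu]
      refine (integral_eq_zero_of_ae (.of_forall fun v => ?_)).symm
      have hmem : Function.update v i u ∉ {v : Fin n → ℝ | v i ∈ s} := by simpa using hu
      simp only [indicator_of_notMem hmem, Pi.zero_apply]
  · exact hmp.integrable_comp_of_integrable hF

theorem IsAllocation.integrableOn {n : ℕ} {z : (Fin n → ℝ) → Fin n → ℝ} (hz : IsAllocation z)
    (i : Fin n) : IntegrableOn (fun v => z v i) (Icc 0 1) := by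
  have hm := measurable_indicator_of_domRestrict (hz.1 i) measurableSet_Icc
  refine IntegrableOn.of_bound (by rw [← Measure.restrict_apply_univ, measure_univ]; simp)
    ?_ 1 ?_
  · refine hm.aestronglyMeasurable.congr ?_
    filter_upwards [ae_restrict_mem measurableSet_Icc] with v hv
    exact indicator_of_mem hv _
  · filter_upwards [ae_restrict_mem measurableSet_Icc] with v hv
    have := (hz.2 v hv).1 i
    rw [Real.norm_of_nonneg this.1]
    exact this.2

/-- Reduced forms of allocations satisfy Border's constraint. -/
theorem Induces.borderValue_le_one {n : ℕ} {z : (Fin n → ℝ) → Fin n → ℝ} {x : Fin n → ℝ → ℝ}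
    (h : Induces z x) {u : Fin n → ℝ} (hu : ∀ i, u i ∈ Icc (0 : ℝ) 1) : borderValue x u ≤ 1 := by
  have hzint := h.1.integrableOn
  have hi : ∀ i, ∫ v in (u i)..1, x i v =
      ∫ v in Icc (0 : Fin n → ℝ) 1, {v : Fin n → ℝ | v i ∈ Ioi (u i)}.indicator
        (fun v => z v i) v := fun i => by
    rw [← integral_interim i measurableSet_Ioi (hzint i), intervalIntegral.integral_of_le (hu i).2,
      setIntegral_indicator measurableSet_Ioi]
    have hset : Icc (0 : ℝ) 1 ∩ Ioi (u i) = Ioc (u i) 1 := by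
      ext w
      exact ⟨fun hw => ⟨hw.2, hw.1.2⟩, fun hw => ⟨⟨(hu i).1.trans hw.1.le, hw.2⟩, hw.1⟩⟩
    rw [hset]
    refine integral_congr_ae (ae_restrict_of_ae_restrict_of_subset ?_ (h.2 i))
    exact fun w hw => ⟨(hu i).1.trans hw.1.le, hw.2⟩
  -- The event that no bidder exceeds the threshold has probability ∏ u_i. On it no winner counts in
  -- the integrals; off it the allocation sums to at most one. Hence the combined integrand is at
  -- most 1.
  set B : Set (Fin n → ℝ) := univ.pi fun i => Iic (u i) with hB
  have hBm : MeasurableSet B := MeasurableSet.univ_pi fun i => measurableSet_Iic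
  have hBvol : ((volume : Measure (Fin n → ℝ)).restrict (Icc 0 1)).real B = ∏ i, u i := by
    rw [volume_restrict_cube, Measure.real, hB, Measure.pi_pi, ENNReal.toReal_prod]
    refine Finset.prod_congr rfl fun i _ => ?_
    rw [Measure.restrict_apply measurableSet_Iic]
    have hset : Iic (u i) ∩ Icc (0 : ℝ) 1 = Icc 0 (u i) := by
      ext w
      exact ⟨fun hw => ⟨hw.2.1, hw.1⟩, fun hw => ⟨hw.2, hw.1, hw.2.trans (hu i).2⟩⟩
    rw [hset]
    simp [(hu i).1]
  have hint : ∀ i, IntegrableOn ({v : Fin n → ℝ | v i ∈ Ioi (u i)}.indicator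
      (fun v => z v i)) (Icc 0 1) := fun i =>
    Integrable.indicator (hzint i) ((measurable_pi_apply i) measurableSet_Ioi)
  have hone : Integrable (B.indicator fun _ => (1 : ℝ))
      ((volume : Measure (Fin n → ℝ)).restrict (Icc 0 1)) :=
    (integrable_const _).indicator hBm
  rw [borderValue, Finset.sum_congr rfl fun i _ => hi i, ← integral_finsetSum _ fun i _ => hint i,
    ← hBvol, ← mul_one (Measure.real _ B), ← smul_eq_mul, ← integral_indicator_const _ hBm,
    ← integral_add hone (integrable_finsetSum _ fun i _ => hint i)]
  calc _ ≤ ∫ v in Icc (0 : Fin n → ℝ) 1, (1 : ℝ) := by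
        refine setIntegral_mono_on (hone.add (integrable_finsetSum _ fun i _ => hint i))
          (integrable_const _) measurableSet_Icc fun v hv => ?_
        obtain ⟨hz01, hzsum⟩ := h.1.2 v hv
        by_cases hvB : v ∈ B
        · rw [indicator_of_mem hvB, Finset.sum_eq_zero, add_zero]
          intro i _
          have hmem : v ∉ {v : Fin n → ℝ | v i ∈ Ioi (u i)} := fun hh =>
            not_lt.2 (mem_Iic.1 (hvB i (mem_univ i))) (mem_Ioi.1 hh)
          simp only [indicator_of_notMem hmem]
        · rw [indicator_of_notMem hvB, zero_add]
          exact (Finset.sum_le_sum fun i _ =>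
            indicator_le_self' (fun _ _ => (hz01 i).1) v).trans hzsum
    _ = 1 := by simp

/-! ### Score allocations and their winning probabilities -/

/-- Right-continuous functions on the unit interval are measurable. -/
theorem RightCts.measurable {g : ℝ → ℝ} (hg : RightCts g) :
    Measurable ((Icc (0 : ℝ) 1).domRestrict g) := by
  -- Rounding up to a grid of mesh 1/(k+1) approaches each u < 1 from the right. The cap keeps the
  -- point in the interval and returns exactly 1 at u = 1, where right-continuity is not available.
  set a : ℕ → ℤ → ℝ := fun k m => min 1 ((m + 1) / (k + 1)) with ha
  have hmeas : ∀ k : ℕ, Measurable fun u : Icc (0 : ℝ) 1 => g (a k ⌊(u : ℝ) * (k + 1)⌋) :=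
    fun k => (Measurable.of_discrete (f := fun m : ℤ => g (a k m))).comp
      (Int.measurable_floor.comp (measurable_subtype_coe.mul_const _))
  refine measurable_of_tendsto_metrizable hmeas (tendsto_pi_nhds.2 fun u => ?_)
  have hlow : ∀ k : ℕ, (u : ℝ) ≤ a k ⌊(u : ℝ) * (k + 1)⌋ := fun k => by
    have hk : (0 : ℝ) < k + 1 := by positivity
    refine le_min u.2.2 ?_
    rw [le_div_iff₀ hk]
    exact (Int.lt_floor_add_one _).le
  rcases u.2.2.lt_or_eq with hu | hu
  · have hconv : Tendsto (fun k : ℕ => a k ⌊(u : ℝ) * (k + 1)⌋) atTop (𝓝 (u : ℝ)) := by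
      have hup : Tendsto (fun k : ℕ => (u : ℝ) + 1 / ((k : ℝ) + 1)) atTop (𝓝 (u : ℝ)) := by
        simpa using (tendsto_const_nhds (x := (u : ℝ))).add
          (tendsto_one_div_add_atTop_nhds_zero_nat (𝕜 := ℝ))
      refine tendsto_of_tendsto_of_tendsto_of_le_of_le tendsto_const_nhds hup hlow fun k => ?_
      have hk : (0 : ℝ) < k + 1 := by positivity
      refine (min_le_right _ _).trans ?_
      rw [div_le_iff₀ hk, add_mul, one_div, inv_mul_cancel₀ hk.ne']
      linarith [Int.floor_le ((u : ℝ) * (k + 1))]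
    exact (hg u ⟨u.2.1, hu⟩).tendsto.comp
      (tendsto_nhdsWithin_iff.2 ⟨hconv, .of_forall hlow⟩)
  · have hone : ∀ k : ℕ, a k ⌊(u : ℝ) * (k + 1)⌋ = u := fun k =>
      le_antisymm ((min_le_left _ _).trans hu.ge) (hlow k)
    simp only [hone]
    exact tendsto_const_nhds

theorem isAllocation_fractionalScoreAllocation {n : ℕ} {q r : Fin n → ℝ → ℝ} (hq : IsScores q)
    (hr : IsFractions r) : IsAllocation (fractionalScoreAllocation q r) := by
  refine ⟨fun i => ?_, fun u hu => ?_⟩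
  · have hcoord : ∀ j, Measurable fun u : Icc (0 : Fin n → ℝ) 1 =>
        (⟨(u : Fin n → ℝ) j, u.2.1 j, u.2.2 j⟩ : Icc (0 : ℝ) 1) := fun j =>
      ((measurable_pi_apply j).comp measurable_subtype_coe).subtype_mk
    have hqm : ∀ j, Measurable fun u : Icc (0 : Fin n → ℝ) 1 => q j ((u : Fin n → ℝ) j) :=
      fun j => ((hq j).2.measurable).comp (hcoord j)
    have hrm : Measurable fun u : Icc (0 : Fin n → ℝ) 1 => r i ((u : Fin n → ℝ) i) :=
      ((hr i).2.measurable).comp (hcoord i)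
    refine Measurable.ite ?_ hrm measurable_const
    simp only [ofPred_forall]
    exact MeasurableSet.iInter fun j => MeasurableSet.iInter fun _ =>
      measurableSet_lt (hqm j) (hqm i)
  · have hr1 : ∀ i, r i (u i) ∈ Icc (0 : ℝ) 1 := fun i => (hr i).1 _ ⟨hu.1 i, hu.2 i⟩
    have h01 : ∀ i, fractionalScoreAllocation q r u i ∈ Icc (0 : ℝ) 1 := fun i => by
      rw [fractionalScoreAllocation]
      split_ifs
      · exact hr1 i
      · exact left_mem_Icc.2 zero_le_one
    refine ⟨h01, ?_⟩
    by_cases hw : ∃ i, ∀ j, j ≠ i → q j (u j) < q i (u i)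
    · obtain ⟨i, hi⟩ := hw
      rw [Finset.sum_eq_single i]
      · exact (h01 i).2
      · intro j _ hj
        exact if_neg fun h => lt_asymm (h i hj.symm) (hi j hj)
      · simp
    · rw [Finset.sum_eq_zero]
      · exact zero_le_one
      · exact fun i _ => if_neg fun h => hw ⟨i, h⟩

/-- The probability that a uniform quantile has a score below `c`. -/
noncomputable def scoreProb (q : ℝ → ℝ) (c : ℝ) : ℝ := uniformUnit.real {v | q v < c}

theorem scoreProb_eq_integral {q : ℝ → ℝ} (hq : StrictMonoOn q (Icc 0 1)) (c : ℝ) :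
    scoreProb q c = ∫ v in Icc (0 : ℝ) 1, if q v < c then (1 : ℝ) else 0 := by
  have hord : OrdConnected (Icc (0 : ℝ) 1 ∩ {v | q v < c}) := by
    refine ⟨fun a ha b hb w hw => ?_⟩
    have hw1 : w ∈ Icc (0 : ℝ) 1 := ⟨ha.1.1.trans hw.1, hw.2.trans hb.1.2⟩
    exact ⟨hw1, (hq.monotoneOn hw1 hb.1 hw.2).trans_lt hb.2⟩
  have hm : MeasurableSet (Icc (0 : ℝ) 1 ∩ {v | q v < c}) := hord.measurableSet
  have hcongr : ∫ v in Icc (0 : ℝ) 1, (if q v < c then (1 : ℝ) else 0) =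
      ∫ v in Icc (0 : ℝ) 1, (Icc (0 : ℝ) 1 ∩ {v | q v < c}).indicator (fun _ => (1 : ℝ)) v := by
    refine setIntegral_congr_fun measurableSet_Icc fun v hv => ?_
    simp only [indicator, mem_inter_iff, hv, true_and, mem_ofPred_eq]
  rw [hcongr, integral_indicator_const _ hm, smul_eq_mul, mul_one, scoreProb, Measure.real,
    Measure.real, Measure.restrict_apply' measurableSet_Icc, Measure.restrict_apply hm]
  congr 2
  ext v
  simp only [mem_inter_iff, mem_ofPred_eq]
  tauto

/-- A strictly increasing score takes each value at most once, so its law has no atoms. This makes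
the highest-score probability as right-continuous as the scores. -/
theorem continuous_scoreProb {q : ℝ → ℝ} (hq : StrictMonoOn q (Icc 0 1)) :
    Continuous (scoreProb q) := by
  refine continuous_iff_continuousAt.2 fun c => ?_
  have hnull : ∀ᵐ v ∂uniformUnit, v ∈ Icc (0 : ℝ) 1 ∧ q v ≠ c := by
    rw [ae_restrict_iff' measurableSet_Icc]
    have hsub : (Icc (0 : ℝ) 1 ∩ {v | q v = c}).Subsingleton := fun a ha b hb =>
      hq.injOn ha.1 hb.1 ((show q a = c from ha.2).trans (show q b = c from hb.2).symm)
    filter_upwards [compl_mem_ae_iff.2 (hsub.measure_zero volume)] with v hv hv1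
    exact ⟨hv1, fun h => hv ⟨hv1, h⟩⟩
  rw [ContinuousAt, funext (scoreProb_eq_integral hq)]
  refine tendsto_integral_filter_of_dominated_convergence (fun _ => 1) (.of_forall fun d => ?_)
    (.of_forall fun d => .of_forall fun v => ?_) (integrable_const _) ?_
  · have hm : AEMeasurable q uniformUnit :=
      aemeasurable_restrict_of_monotoneOn measurableSet_Icc hq.monotoneOn
    have h1 : Measurable fun y : ℝ => if y < d then (1 : ℝ) else 0 :=
      Measurable.ite measurableSet_Iio measurable_const measurable_const
    exact (h1.comp_aemeasurable hm).aestronglyMeasurable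
  · split_ifs <;> simp
  · filter_upwards [hnull] with v hv
    rcases lt_or_gt_of_ne hv.2 with h | h
    · refine tendsto_const_nhds.congr' ?_
      filter_upwards [lt_mem_nhds h] with d hd
      rw [if_pos h, if_pos hd]
    · refine tendsto_const_nhds.congr' ?_
      filter_upwards [gt_mem_nhds h] with d hd
      rw [if_neg h.not_gt, if_neg hd.not_gt]

theorem scoreProb_nonneg (q : ℝ → ℝ) (c : ℝ) : 0 ≤ scoreProb q c := measureReal_nonneg

theorem scoreProb_le_one (q : ℝ → ℝ) (c : ℝ) : scoreProb q c ≤ 1 := measureReal_le_one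

theorem scoreProb_score {q : ℝ → ℝ} (hq : StrictMonoOn q (Icc 0 1)) {a : ℝ}
    (ha : a ∈ Icc (0 : ℝ) 1) : scoreProb q (q a) = a := by
  have : {v | q v < q a} ∩ Icc (0 : ℝ) 1 = Ico 0 a := by
    ext v
    constructor
    · rintro ⟨h1, h2⟩
      exact ⟨h2.1, (hq.lt_iff_lt h2 ha).1 h1⟩
    · intro h
      have hv : v ∈ Icc (0 : ℝ) 1 := ⟨h.1, h.2.le.trans ha.2⟩
      exact ⟨(hq.lt_iff_lt hv ha).2 h.2, hv⟩
  rw [scoreProb, Measure.real, Measure.restrict_apply' measurableSet_Icc, this]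
  simp [ha.1]

/-- With the own score fixed, winning is a box event in the other quantiles, so independence yields
the product. The own factor of the box is the whole line. -/
theorem interim_fractionalScoreAllocation {n : ℕ} {q : Fin n → ℝ → ℝ} (hq : IsScores q)
    (r : Fin n → ℝ → ℝ) (i : Fin n) (u : ℝ) :
    interim (fractionalScoreAllocation q r) i u =
      r i u * ∏ j ∈ Finset.univ.erase i, scoreProb (q j) (q i u) := by
  set c := q i u with hc
  set S : Fin n → Set ℝ := fun j => Icc (0 : ℝ) 1 ∩ {v | q j v < c} with hS
  have hSm : ∀ j, MeasurableSet (S j) := fun j => by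
    refine OrdConnected.measurableSet ⟨fun a ha b hb w hw => ?_⟩
    have hw1 : w ∈ Icc (0 : ℝ) 1 := ⟨ha.1.1.trans hw.1, hw.2.trans hb.1.2⟩
    exact ⟨hw1, ((hq j).1.monotoneOn hw1 hb.1 hw.2).trans_lt hb.2⟩
  set B : Set (Fin n → ℝ) := univ.pi (Function.update S i univ) with hB
  have hBm : MeasurableSet B := MeasurableSet.univ_pi fun j => by
    by_cases hj : j = i
    · subst hj; simp
    · simpa [hj] using hSm j
  have hcongr : interim (fractionalScoreAllocation q r) i u =
      ∫ v in Icc (0 : Fin n → ℝ) 1, B.indicator (fun _ => r i u) v := by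
    refine setIntegral_congr_fun measurableSet_Icc fun v hv => ?_
    have hiff : (∀ j, j ≠ i → q j (Function.update v i u j) <
        q i (Function.update v i u i)) ↔ v ∈ B := by
      simp only [hB, Set.mem_pi, mem_univ, forall_const, Function.update_self]
      refine forall_congr' fun j => ?_
      by_cases hj : j = i
      · subst hj; simp
      · simp only [ne_eq, hj, not_false_eq_true, forall_const, Function.update_of_ne, hS,
          mem_inter_iff, mem_ofPred_eq, ← hc]
        exact ⟨fun h => ⟨⟨hv.1 j, hv.2 j⟩, h⟩, fun h => h.2⟩
    by_cases hvB : v ∈ B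
    · rw [fractionalScoreAllocation, if_pos (hiff.2 hvB), Function.update_self,
        indicator_of_mem hvB]
    · rw [fractionalScoreAllocation, if_neg (mt hiff.1 hvB), indicator_of_notMem hvB]
  rw [hcongr, integral_indicator_const _ hBm, smul_eq_mul, mul_comm, volume_restrict_cube,
    Measure.real, hB, Measure.pi_pi, ENNReal.toReal_prod,
    ← Finset.mul_prod_erase _ _ (Finset.mem_univ i), Function.update_self, measure_univ,
    ENNReal.toReal_one, one_mul]
  refine congrArg _ (Finset.prod_congr rfl fun j hj => ?_)
  rw [Function.update_of_ne (Finset.ne_of_mem_erase hj), scoreProb, Measure.real,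
    Measure.restrict_apply' measurableSet_Icc, Measure.restrict_apply' measurableSet_Icc, hS]
  congr 2
  ext v
  simp only [mem_inter_iff, mem_ofPred_eq]
  tauto

/-! ### First hitting times, the cutoff and the construction of scores -/

/-- A nonzero supremum in `cdfOfDelta` is attained. Take the hyperbola through the graph point at u:
the criterion says that the path reaches -log u by its time t, and applied at a hitting time t' ≤ t
it forces t' = t. -/
theorem IsDeltaPath.exists_first {δ : ℝ → ℝ} (h : IsDeltaPath δ) {u : ℝ} (hu : 0 < u)
    (hu1 : u ≤ 1) (hx : cdfOfDelta {t | 0 ≤ t} δ u ≠ 0) :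
    ∃ t, 0 ≤ t ∧ Real.exp (-δ t) = u ∧ cdfOfDelta {t | 0 ≤ t} δ u = Real.exp (δ t - t) := by
  set x := cdfOfDelta {t | 0 ≤ t} δ u with hxdef
  have hx0 : 0 < x := (IsDeltaPath.cdfOfDelta_nonneg_of_pos hu).lt_of_ne hx.symm
  have hx1 : x ≤ 1 := h.cdfOfDelta_le_one_of_pos hu
  have hm0 : 0 < u * x := mul_pos hu hx0
  have hs : 0 ≤ -Real.log u := by linarith [Real.log_nonpos hu.le hu1]
  set t := -Real.log (u * x) with ht
  have ht0 : 0 ≤ t := by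
    linarith [Real.log_nonpos hm0.le (mul_le_one₀ hu1 hx0.le hx1)]
  have hte : Real.exp (-t) = u * x := by rw [ht, neg_neg, Real.exp_log hm0]
  obtain ⟨t', ht', hδ⟩ := h.exists_eq ht0 hs
    ((h.exp_neg_le_mul_cdfOfDelta_iff hu hu1 ht0).1 hte.le)
  have hle := (h.exp_neg_le_mul_cdfOfDelta_iff hu hu1 ht'.1).2 hδ.ge
  rw [← hxdef, ← hte, Real.exp_le_exp] at hle
  have htt : t' = t := le_antisymm ht'.2 (by linarith)
  rw [htt] at hδ
  refine ⟨t, ht0, by rw [hδ, neg_neg, Real.exp_log hu], ?_⟩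
  rw [sub_eq_add_neg, Real.exp_add, hte, hδ, Real.exp_neg, Real.exp_log hu,
    inv_mul_cancel_left₀ hu.ne']

theorem cutoff_nonneg (p : ℝ → ℝ) : 0 ≤ cutoff p := by
  refine le_sInf ?_
  rintro _ ⟨t, ht, rfl⟩
  exact EReal.coe_nonneg.2 ht.1

theorem pos_of_lt_cutoff {p : ℝ → ℝ} {t : ℝ} (ht : 0 ≤ t) (h : (t : EReal) < cutoff p) :
    0 < p t := by
  by_contra! hp
  exact h.not_ge (sInf_le ⟨t, ⟨ht, hp⟩, rfl⟩)

theorem nonneg_of_cutoff_le {p : ℝ → ℝ} {t : ℝ} (h : cutoff p ≤ (t : EReal)) : 0 ≤ t :=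
  EReal.coe_nonneg.1 ((cutoff_nonneg p).trans h)

/-- At the cutoff itself the infimum is not known to be attained; monotonicity gives the sign
strictly to the right and continuity carries it back. -/
theorem nonpos_of_cutoff_le {p : ℝ → ℝ} (hp : StrictAntiOn p (Ici 0))
    (hc : ContinuousOn p (Ici 0)) {t : ℝ} (h : cutoff p ≤ (t : EReal)) : p t ≤ 0 := by
  have ht : 0 ≤ t := nonneg_of_cutoff_le h
  have hlim : Tendsto p (𝓝[>] t) (𝓝 (p t)) :=
    (hc t ht).mono_left (nhdsWithin_mono _ fun s hs => ht.trans (mem_Ioi.1 hs).le)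
  refine le_of_tendsto hlim ?_
  filter_upwards [self_mem_nhdsWithin] with s hs
  have hs : t < s := hs
  obtain ⟨_, ⟨r, hr, rfl⟩, hrs⟩ := sInf_lt_iff.1 (h.trans_lt (EReal.coe_lt_coe_iff.2 hs))
  have hrs : r < s := EReal.coe_lt_coe_iff.1 hrs
  exact (hp hr.1 (ht.trans hs.le) hrs).le.trans hr.2

theorem MonotoneOn.continuousWithinAt_Ici_of_exists {q : ℝ → ℝ} {a b u : ℝ}
    (hq : MonotoneOn q (Icc a b)) (hu : u ∈ Icc a b)
    (h : ∀ c, q u < c → ∃ v ∈ Ioc u b, q v < c) : ContinuousWithinAt q (Ici u) u := by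
  refine tendsto_order.2 ⟨fun c hc => ?_, fun c hc => ?_⟩
  · obtain ⟨v, hv, -⟩ := h (q u + 1) (by linarith)
    filter_upwards [Icc_mem_nhdsGE hv.1] with w hw
    exact hc.trans_le (hq hu ⟨hu.1.trans hw.1, hw.2.trans hv.2⟩ hw.1)
  · obtain ⟨v, hv, hvc⟩ := h c hc
    filter_upwards [Icc_mem_nhdsGE hv.1] with w hw
    exact (hq ⟨hu.1.trans hw.1, hw.2.trans hv.2⟩ ⟨hu.1.trans hv.1.le, hv.2⟩ hw.2).trans_lt hvc

/-- A score with prescribed values along an increasing path. -/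
theorem IsDeltaPath.exists_score {δ p : ℝ → ℝ} (h : IsDeltaPath δ)
    (hδ : StrictMonoOn δ (Ici 0)) (hp : StrictAntiOn p (Ici 0)) (hpc : ContinuousOn p (Ici 0))
    {m : ℝ} (hm : ∀ t, 0 ≤ t → m ≤ p t) :
    ∃ q : ℝ → ℝ, StrictMonoOn q (Icc 0 1) ∧ RightCts q ∧
      ∀ t, 0 ≤ t → q (Real.exp (-δ t)) = p t := by
  have hbddE : BddBelow (range fun t : Ici (0 : ℝ) => Real.exp (-δ t)) :=
    ⟨0, by rintro _ ⟨t, rfl⟩; exact (Real.exp_pos _).le⟩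
  have hbddP : BddBelow (range fun t : Ici (0 : ℝ) => p t) :=
    ⟨m, by rintro _ ⟨t, rfl⟩; exact hm t t.2⟩
  -- The path prescribes scores only above u₀. The lower bound `m` makes the infimum p₀ of the
  -- prescribed scores a genuine one.
  set u₀ := ⨅ t : Ici (0 : ℝ), Real.exp (-δ t) with hu₀
  set p₀ := ⨅ t : Ici (0 : ℝ), p t with hp₀
  have hu₀lt : ∀ t, 0 ≤ t → u₀ < Real.exp (-δ t) := fun t ht => by
    have h1 : (0 : ℝ) ≤ t + 1 := by linarith
    refine (ciInf_le hbddE ⟨t + 1, h1⟩).trans_lt (Real.exp_lt_exp.2 (neg_lt_neg ?_))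
    exact hδ ht h1 (by linarith)
  have hp₀lt : ∀ t, 0 ≤ t → p₀ < p t := fun t ht => by
    have h1 : (0 : ℝ) ≤ t + 1 := by linarith
    exact (ciInf_le hbddP ⟨t + 1, h1⟩).trans_lt (hp ht h1 (by linarith))
  have hex : ∀ u, ∃ t, u₀ < u → u ≤ 1 → 0 ≤ t ∧ Real.exp (-δ t) = u := fun u => by
    by_cases hu : u₀ < u ∧ u ≤ 1
    · obtain ⟨t, ht⟩ := exists_lt_of_ciInf_lt hu.1
      have hu0 : 0 < u := (Real.exp_pos _).trans ht
      have hlog := (Real.lt_log_iff_exp_lt hu0).2 ht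
      obtain ⟨t', ht', he⟩ := h.exists_eq (s := -Real.log u) t.2
        (by linarith [Real.log_nonpos hu0.le hu.2]) (by linarith)
      exact ⟨t', fun _ _ => ⟨ht'.1, by rw [he, neg_neg, Real.exp_log hu0]⟩⟩
    · exact ⟨0, fun h1 h2 => absurd ⟨h1, h2⟩ hu⟩
  choose τ hτ using hex
  have hinj : ∀ s t, 0 ≤ s → 0 ≤ t → Real.exp (-δ s) = Real.exp (-δ t) → s = t :=
    fun s t hs ht he => hδ.injOn hs ht (by simpa using he)
  -- Up to u₀ a line of slope one ending at p₀ keeps the score strictly increasing and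
  -- right-continuous at the junction.
  set q : ℝ → ℝ := fun u => if u ≤ u₀ then p₀ + (u - u₀) else p (τ u) with hq
  have hqle : ∀ u, u ≤ u₀ → q u = p₀ + (u - u₀) := fun u hu => if_pos hu
  have hqpath : ∀ t, 0 ≤ t → q (Real.exp (-δ t)) = p t := fun t ht => by
    have h1 := hu₀lt t ht
    obtain ⟨h2, h3⟩ := hτ _ h1 (IsCDF.exp_neg_mem (h.nonneg ht)).2
    simp only [hq, if_neg h1.not_ge]
    rw [hinj _ _ h2 ht h3]
  have hqmono : StrictMonoOn q (Icc 0 1) := fun u hu v hv huv => by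
    rcases le_or_gt v u₀ with hv0 | hv0
    · rw [hqle u (huv.le.trans hv0), hqle v hv0]
      linarith
    · obtain ⟨ht, htv⟩ := hτ v hv0 hv.2
      rw [← htv, hqpath _ ht]
      rcases le_or_gt u u₀ with hu0 | hu0
      · rw [hqle u hu0]
        linarith [hp₀lt _ ht]
      · obtain ⟨hs, hsu⟩ := hτ u hu0 hu.2
        rw [← hsu, hqpath _ hs]
        refine hp ht hs ((hδ.lt_iff_lt ht hs).1 ?_)
        rw [← hsu, ← htv, Real.exp_lt_exp] at huv
        linarith
  refine ⟨q, hqmono, fun u hu => ?_, hqpath⟩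
  refine hqmono.monotoneOn.continuousWithinAt_Ici_of_exists ⟨hu.1, hu.2.le⟩ fun c hc => ?_
  rcases lt_trichotomy u u₀ with hu0 | rfl | hu0
  · rw [hqle u hu0.le] at hc
    have hu₀1 : u₀ ≤ 1 := (hu₀lt 0 le_rfl).le.trans (by simp [h.zero])
    obtain ⟨v, hv1, hv2⟩ := exists_between (lt_min hu0 (show u < u + (c - (p₀ + (u - u₀))) by
      linarith))
    have hv := lt_min_iff.1 hv2
    refine ⟨v, ⟨hv1, hv.1.le.trans hu₀1⟩, ?_⟩
    rw [hqle v hv.1.le]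
    linarith [hv.2]
  · rw [hqle _ le_rfl, sub_self, add_zero] at hc
    obtain ⟨t, ht⟩ := exists_lt_of_ciInf_lt hc
    exact ⟨_, ⟨hu₀lt t t.2, (IsCDF.exp_neg_mem (h.nonneg t.2)).2⟩, by rwa [hqpath _ t.2]⟩
  · obtain ⟨ht, htu⟩ := hτ u hu0 hu.2.le
    set t := τ u
    rw [← htu, hqpath t ht] at hc
    have htpos : 0 < t := ht.lt_of_ne fun h0 => by
      rw [← h0, h.zero, neg_zero, Real.exp_zero] at htu
      linarith [hu.2]
    have hcont : ContinuousAt p t := (hpc t ht).continuousAt (Ici_mem_nhds htpos)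
    -- Quantiles to the right correspond to earlier times, so right-continuity of the score comes
    -- from left-continuity of `p`.
    have hev : ∀ᶠ s in 𝓝[<] t, p s < c := nhdsWithin_le_nhds (hcont.eventually_lt_const hc)
    obtain ⟨s, hsc, hs⟩ := (hev.and (Ioo_mem_nhdsLT htpos)).exists
    refine ⟨Real.exp (-δ s), ⟨?_, (IsCDF.exp_neg_mem (h.nonneg hs.1.le)).2⟩, ?_⟩
    · rw [← htu]
      exact Real.exp_lt_exp.2 (neg_lt_neg (hδ hs.1.le ht hs.2))
    · rwa [hqpath s hs.1.le]

/-! ### The sharp and dagger paths and their junction at the cutoff -/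

namespace AuctionEnv

variable {n : ℕ} {E : AuctionEnv n} {δs δd : Fin n → ℝ → ℝ} {ps : ℝ → ℝ}

theorem IsRegular.nonempty (hE : E.IsRegular) : Nonempty (Fin n) := by
  obtain ⟨s, hs, -⟩ := hE.unique 1 zero_le_one
  by_contra hn
  rw [not_nonempty_iff] at hn
  have := hs.2.2
  rw [Finset.univ_eq_empty, Finset.sum_empty] at this
  exact zero_ne_one this

/-- The heights sum to t and each is increasing, so no single increment can exceed the elapsed time;
at time 0 nonnegative heights with sum 0 all vanish. -/
theorem IsSharpPath.isDeltaPath (hs : E.IsSharpPath δs ps) (hE : E.IsRegular) (i : Fin n) :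
    IsDeltaPath (δs i) := by
  have hmono : ∀ j s t, 0 ≤ s → s ≤ t → δs j s ≤ δs j t := fun j s t h0 hst =>
    ((hE.monotone δs ps hs).1 j).monotoneOn h0 (h0.trans hst) hst
  refine ⟨?_, hmono i, fun s t h0 hst => ?_⟩
  · have h := hs 0 le_rfl
    exact (Finset.sum_eq_zero_iff_of_nonneg fun j _ => h.1 j).1 h.2.2 i (Finset.mem_univ i)
  · have h1 := (hs s h0).2.2
    have h2 := (hs t (h0.trans hst)).2.2
    have h3 : ∑ j, (δs j t - δs j s) = t - s := by rw [Finset.sum_sub_distrib, h1, h2]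
    rw [← h3]
    exact Finset.single_le_sum (f := fun j => δs j t - δs j s)
      (fun j _ => sub_nonneg.2 (hmono j s t h0 hst)) (Finset.mem_univ i)

theorem IsSharpPath.mem_Icc (hs : E.IsSharpPath δs ps) (hE : E.IsRegular) (i : Fin n) {t : ℝ}
    (ht : 0 ≤ t) : δs i t ∈ Icc 0 t :=
  ⟨(hs.isDeltaPath hE i).nonneg ht, (hs.isDeltaPath hE i).le_self ht⟩

theorem IsSharpPath.continuousOn (hs : E.IsSharpPath δs ps) (hE : E.IsRegular) :
    ContinuousOn ps (Ici 0) := by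
  obtain ⟨i⟩ := hE.nonempty
  have hδ := (hs.isDeltaPath hE i).continuousOn
  have : ContinuousOn (fun t => E.marginalRevenue i (δs i t) t) (Ici 0) := by
    refine (E.dH_continuousOn i).comp
      (f := fun t : ℝ => (Real.exp (δs i t - t), Real.exp (-δs i t)))
      ((Real.continuous_exp.comp_continuousOn (hδ.sub continuousOn_id)).prodMk
        (Real.continuous_exp.comp_continuousOn hδ.neg)) fun t ht => ?_
    have h := hs.mem_Icc hE i ht
    exact ⟨⟨(Real.exp_pos _).le, Real.exp_le_one_iff.2 (by linarith [h.2])⟩,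
      IsCDF.exp_neg_mem h.1⟩
  exact this.congr fun t ht => ((hs t ht).2.1 i).symm

theorem IsSharpPath.exists_le (hs : E.IsSharpPath δs ps) (hE : E.IsRegular) :
    ∃ m, ∀ t, 0 ≤ t → m ≤ ps t := by
  obtain ⟨i⟩ := hE.nonempty
  obtain ⟨M, hM⟩ := E.exists_abs_dH_le i
  refine ⟨-M, fun t ht => ?_⟩
  have h := hs.mem_Icc hE i ht
  rw [← (hs t ht).2.1 i]
  exact neg_le_of_abs_le (hM _
    ⟨(Real.exp_pos _).le, Real.exp_le_one_iff.2 (by linarith [h.2])⟩ _ (IsCDF.exp_neg_mem h.1))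

theorem IsSharpPath.exists_scores (hs : E.IsSharpPath δs ps) (hE : E.IsRegular) :
    ∃ q, IsPrincipalVirtualValue δs ps q := by
  obtain ⟨m, hm⟩ := hs.exists_le hE
  have hmono := hE.monotone δs ps hs
  choose q hq using fun i => (hs.isDeltaPath hE i).exists_score (hmono.1 i) hmono.2
    (hs.continuousOn hE) hm
  exact ⟨q, fun i => ⟨(hq i).1, (hq i).2.1⟩, fun i => (hq i).2.2⟩

/-- From the cutoff on, marginal revenue is p♯ ≤ 0 on the sharp path and 0 on the dagger path, and
it strictly decreases in the height. -/
theorem IsSharpPath.dagger_le (hs : E.IsSharpPath δs ps) (hE : E.IsRegular)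
    (hd : E.IsDaggerPath (cutoff ps) δd) (i : Fin n) {t : ℝ} (h : cutoff ps ≤ (t : EReal)) :
    δd i t ≤ δs i t := by
  have ht := nonneg_of_cutoff_le h
  by_contra! hlt
  have := hE.marginalRevenue_strictAntiOn i ht (hs.mem_Icc hE i ht) (hd i t h).1 hlt
  simp only [(hs t ht).2.1 i, (hd i t h).2] at this
  exact this.not_ge (nonpos_of_cutoff_le (hE.monotone δs ps hs).2 (hs.continuousOn hE) h)

/-- The two paths meet at the cutoff. -/
theorem IsSharpPath.dagger_eq (hs : E.IsSharpPath δs ps) (hE : E.IsRegular)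
    (hd : E.IsDaggerPath (cutoff ps) δd) (i : Fin n) {a : ℝ} (h : cutoff ps = (a : EReal)) :
    δd i a = δs i a := by
  have ha := nonneg_of_cutoff_le h.le
  have hsm := hs.mem_Icc hE i ha
  have hdm := hd i a h.le
  have hp0 : ps a ≤ 0 :=
    nonpos_of_cutoff_le (hE.monotone δs ps hs).2 (hs.continuousOn hE) h.le
  -- A cutoff of 0 is separate: p♯ need not vanish there, but the interval of heights is a single
  -- point. Otherwise positivity before the cutoff gives p♯ ≥ 0 in the limit.
  rcases ha.eq_or_lt with rfl | hapos
  · exact le_antisymm (hdm.1.2.trans hsm.1) (hsm.2.trans hdm.1.1)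
  · have hp1 : 0 ≤ ps a := by
      have hcont : ContinuousAt ps a :=
        (hs.continuousOn hE a ha).continuousAt (Ici_mem_nhds hapos)
      refine ge_of_tendsto (hcont.tendsto.mono_left nhdsWithin_le_nhds : Tendsto ps (𝓝[<] a) _) ?_
      filter_upwards [Ioo_mem_nhdsLT hapos] with t ht
      exact (pos_of_lt_cutoff ht.1.le (h ▸ EReal.coe_lt_coe_iff.2 ht.2)).le
    refine (hE.marginalRevenue_strictAntiOn i ha).injOn hdm.1 hsm ?_
    simp only [(hs a ha).2.1 i, hdm.2]
    exact le_antisymm hp1 hp0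

theorem optimalDelta_of_lt {T : EReal} {i : Fin n} {t : ℝ} (h : (t : EReal) < T) :
    optimalDelta T δs δd i t = δs i t := if_pos h

theorem optimalDelta_of_le {T : EReal} {i : Fin n} {t : ℝ} (h : T ≤ (t : EReal)) :
    optimalDelta T δs δd i t = δd i t := if_neg h.not_gt

theorem IsSharpPath.isDeltaPath_optimalDelta (hs : E.IsSharpPath δs ps) (hE : E.IsRegular)
    (hd : E.IsDaggerPath (cutoff ps) δd)
    (hslope : ∀ i (s t : ℝ), cutoff ps ≤ (s : EReal) → s ≤ t →
      0 ≤ δd i t - δd i s ∧ δd i t - δd i s ≤ t - s) (i : Fin n) :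
    IsDeltaPath (optimalDelta (cutoff ps) δs δd i) := by
  have hδ := hs.isDeltaPath hE i
  have key : ∀ s t, 0 ≤ s → s ≤ t →
      0 ≤ optimalDelta (cutoff ps) δs δd i t - optimalDelta (cutoff ps) δs δd i s ∧
      optimalDelta (cutoff ps) δs δd i t - optimalDelta (cutoff ps) δs δd i s ≤ t - s := by
    intro s t h0 hst
    rcases lt_or_ge (t : EReal) (cutoff ps) with ht | ht
    · rw [optimalDelta_of_lt ht,
        optimalDelta_of_lt ((EReal.coe_le_coe_iff.2 hst).trans_lt ht)]
      exact ⟨sub_nonneg.2 (hδ.mono s t h0 hst), hδ.slope s t h0 hst⟩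
    · rw [optimalDelta_of_le ht]
      rcases lt_or_ge (s : EReal) (cutoff ps) with hs' | hs'
      -- Across the cutoff a, both bounds add over [s, a] and [a, t] because the paths agree at a.
      · rw [optimalDelta_of_lt hs']
        have htop : cutoff ps ≠ ⊤ := (ht.trans_lt (EReal.coe_lt_top t)).ne
        have hbot : cutoff ps ≠ ⊥ := (bot_lt_iff_ne_bot.1 (hs'.trans_le' bot_le))
        have ha : cutoff ps = ((cutoff ps).toReal : EReal) := (EReal.coe_toReal htop hbot).symm
        set a := (cutoff ps).toReal
        rw [ha] at ht hs'
        have hsa := EReal.coe_lt_coe_iff.1 hs'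
        have hat := EReal.coe_le_coe_iff.1 ht
        have h1 := hslope i a t ha.le hat
        have h2 := hs.dagger_eq hE hd i ha
        have h3 := hδ.mono s a h0 hsa.le
        have h4 := hδ.slope s a h0 hsa.le
        constructor <;> linarith [h1.1, h1.2]
      · rw [optimalDelta_of_le hs']
        exact hslope i s t hs' hst
  refine ⟨?_, fun s t h0 hst => sub_nonneg.1 (key s t h0 hst).1,
    fun s t h0 hst => (key s t h0 hst).2⟩
  rcases lt_or_ge ((0 : ℝ) : EReal) (cutoff ps) with h | h
  · rw [optimalDelta_of_lt h, hδ.zero]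
  · rw [optimalDelta_of_le h]
    exact le_antisymm (hd i 0 h).1.2 (hd i 0 h).1.1

theorem cutoff_eq_top_or_coe (ps : ℝ → ℝ) :
    cutoff ps = ⊤ ∨ ∃ a : ℝ, cutoff ps = (a : EReal) := by
  rcases eq_or_ne (cutoff ps) ⊤ with h | h
  · exact .inl h
  · refine .inr ⟨(cutoff ps).toReal, (EReal.coe_toReal h ?_).symm⟩
    exact (EReal.bot_lt_zero.trans_le (cutoff_nonneg ps)).ne'

theorem IsSharpPath.optimalDelta_of_le_cutoff (hs : E.IsSharpPath δs ps) (hE : E.IsRegular)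
    (hd : E.IsDaggerPath (cutoff ps) δd) (i : Fin n) {t : ℝ} (h : (t : EReal) ≤ cutoff ps) :
    optimalDelta (cutoff ps) δs δd i t = δs i t := by
  rcases h.lt_or_eq with h | h
  · exact optimalDelta_of_lt h
  · rw [optimalDelta_of_le h.ge, hs.dagger_eq hE hd i h.symm]

theorem IsSharpPath.thresholdQuantile_of_eq_coe (hs : E.IsSharpPath δs ps) (hE : E.IsRegular)
    (hd : E.IsDaggerPath (cutoff ps) δd) (i : Fin n) {a : ℝ} (h : cutoff ps = (a : EReal)) :
    thresholdQuantile (cutoff ps) δs δd i = Real.exp (-δs i a) := by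
  rw [thresholdQuantile, if_neg (h ▸ EReal.coe_ne_top a),
    show (cutoff ps).toReal = a by rw [h, EReal.toReal_coe],
    hs.optimalDelta_of_le_cutoff hE hd i h.ge]

theorem IsSharpPath.thresholdQuantile_le (hs : E.IsSharpPath δs ps) (hE : E.IsRegular)
    (hd : E.IsDaggerPath (cutoff ps) δd) (i : Fin n) {t : ℝ} (ht : 0 ≤ t)
    (h : (t : EReal) < cutoff ps) :
    thresholdQuantile (cutoff ps) δs δd i ≤ Real.exp (-δs i t) := by
  rcases cutoff_eq_top_or_coe ps with hT | ⟨a, ha⟩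
  · rw [thresholdQuantile, if_pos hT, ← optimalDelta_of_lt (δs := δs) (δd := δd) (i := i) h]
    exact ciInf_le (f := fun t : Ici (0 : ℝ) =>
      Real.exp (-optimalDelta (cutoff ps) δs δd i t))
      ⟨0, by rintro _ ⟨t, rfl⟩; exact (Real.exp_pos _).le⟩ ⟨t, ht⟩
  · rw [hs.thresholdQuantile_of_eq_coe hE hd i ha]
    rw [ha] at h
    exact Real.exp_le_exp.2 (neg_le_neg
      ((hs.isDeltaPath hE i).mono t a ht (EReal.coe_lt_coe_iff.1 h).le))

/-- Quantiles above the threshold are reached before the cutoff. -/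
theorem IsSharpPath.exists_of_thresholdQuantile_lt (hs : E.IsSharpPath δs ps)
    (hE : E.IsRegular) (hd : E.IsDaggerPath (cutoff ps) δd) (i : Fin n) {u : ℝ}
    (hu : thresholdQuantile (cutoff ps) δs δd i < u) (hu1 : u ≤ 1) :
    ∃ t : ℝ, 0 ≤ t ∧ (t : EReal) ≤ cutoff ps ∧ Real.exp (-δs i t) = u := by
  have hδ := hs.isDeltaPath hE i
  have key : ∀ t : ℝ, 0 ≤ t → (t : EReal) ≤ cutoff ps → Real.exp (-δs i t) < u →
      ∃ t : ℝ, 0 ≤ t ∧ (t : EReal) ≤ cutoff ps ∧ Real.exp (-δs i t) = u := fun t ht htT hlt => by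
    have hu0 : 0 < u := (Real.exp_pos _).trans hlt
    have hlog := (Real.lt_log_iff_exp_lt hu0).2 hlt
    obtain ⟨t', ht', he⟩ := hδ.exists_eq (s := -Real.log u) ht
      (by linarith [Real.log_nonpos hu0.le hu1]) (by linarith)
    exact ⟨t', ht'.1, (EReal.coe_le_coe_iff.2 ht'.2).trans htT,
      by rw [he, neg_neg, Real.exp_log hu0]⟩
  rcases cutoff_eq_top_or_coe ps with hT | ⟨a, ha⟩
  · rw [thresholdQuantile, if_pos hT] at hu
    obtain ⟨t, ht⟩ := exists_lt_of_ciInf_lt hu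
    have htT : ((t : ℝ) : EReal) < cutoff ps := hT ▸ EReal.coe_lt_top _
    rw [optimalDelta_of_lt htT] at ht
    exact key t t.2 htT.le ht
  · rw [hs.thresholdQuantile_of_eq_coe hE hd i ha] at hu
    exact key a (nonneg_of_cutoff_le ha.le) ha.ge hu

end AuctionEnv

/-! ### Winning fractions, the induced form and its optimality -/

/-- The interim probability of having the highest score. -/
noncomputable def highScoreProb {n : ℕ} (q : Fin n → ℝ → ℝ) (i : Fin n) (u : ℝ) : ℝ :=
  ∏ j ∈ Finset.univ.erase i, scoreProb (q j) (q i u)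

theorem highScoreProb_mem {n : ℕ} (q : Fin n → ℝ → ℝ) (i : Fin n) (u : ℝ) :
    highScoreProb q i u ∈ Icc (0 : ℝ) 1 :=
  ⟨Finset.prod_nonneg fun _ _ => scoreProb_nonneg _ _,
    Finset.prod_le_one (fun _ _ => scoreProb_nonneg _ _) fun _ _ => scoreProb_le_one _ _⟩

theorem IsScores.highScoreProb_rightCts {n : ℕ} {q : Fin n → ℝ → ℝ} (hq : IsScores q)
    (i : Fin n) : RightCts (highScoreProb q i) := fun u hu => by
  have hc : Continuous fun c => ∏ j ∈ Finset.univ.erase i, scoreProb (q j) c :=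
    continuous_finsetProd _ fun j _ => continuous_scoreProb (hq j).1
  exact hc.continuousAt.comp_continuousWithinAt ((hq i).2 u hu)

theorem interim_one_eq_highScoreProb {n : ℕ} {q : Fin n → ℝ → ℝ} (hq : IsScores q) (i : Fin n)
    (u : ℝ) : interim (fractionalScoreAllocation q fun _ _ => 1) i u = highScoreProb q i u := by
  rw [interim_fractionalScoreAllocation hq, one_mul, highScoreProb]

namespace AuctionEnv

variable {n : ℕ} {E : AuctionEnv n} {δs δd : Fin n → ℝ → ℝ} {ps : ℝ → ℝ}

/-- The reduced form recovered from the path that switches at the cutoff. -/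
noncomputable def optimalForm (ps : ℝ → ℝ) (δs δd : Fin n → ℝ → ℝ) (i : Fin n) : ℝ → ℝ :=
  cdfOfDelta {t | 0 ≤ t} (optimalDelta (cutoff ps) δs δd i)

/-- Bidder j scores below p♯(t) exactly when the quantile is below e^{-δ♯_j(t)}. The product over j
≠ i is e^{δ♯_i(t)-t} because the heights sum to t. -/
theorem IsSharpPath.highScoreProb_exp (hs : E.IsSharpPath δs ps) (hE : E.IsRegular)
    {q : Fin n → ℝ → ℝ} (hq : IsPrincipalVirtualValue δs ps q) (i : Fin n) {t : ℝ}
    (ht : 0 ≤ t) : highScoreProb q i (Real.exp (-δs i t)) = Real.exp (δs i t - t) := by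
  have hj : ∀ j, scoreProb (q j) (q i (Real.exp (-δs i t))) = Real.exp (-δs j t) := fun j => by
    rw [hq.2 i t ht, ← hq.2 j t ht]
    exact scoreProb_score (hq.1 j).1 (IsCDF.exp_neg_mem (hs.mem_Icc hE j ht).1)
  rw [highScoreProb, Finset.prod_congr rfl fun j _ => hj j, ← Real.exp_sum]
  have hsum := (hs t ht).2.2
  rw [← Finset.add_sum_erase _ _ (Finset.mem_univ i)] at hsum
  rw [Finset.sum_neg_distrib]
  congr 1
  linarith

/-- Above the threshold, the optimal form is the probability of having the highest score. -/
theorem IsSharpPath.optimalForm_of_thresholdQuantile_lt (hs : E.IsSharpPath δs ps)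
    (hE : E.IsRegular) (hd : E.IsDaggerPath (cutoff ps) δd)
    (hδ : ∀ i, IsDeltaPath (optimalDelta (cutoff ps) δs δd i))
    {q : Fin n → ℝ → ℝ} (hq : IsPrincipalVirtualValue δs ps q) (i : Fin n) {u : ℝ}
    (hu : thresholdQuantile (cutoff ps) δs δd i < u) (hu1 : u ≤ 1) :
    optimalForm ps δs δd i u = highScoreProb q i u := by
  obtain ⟨t, ht, htT, rfl⟩ := hs.exists_of_thresholdQuantile_lt hE hd i hu hu1
  rw [hs.highScoreProb_exp hE hq i ht, optimalForm, ← hs.optimalDelta_of_le_cutoff hE hd i htT]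
  refine (hδ i).cdfOfDelta_exp ht fun s h0 hst => ?_
  rw [hs.optimalDelta_of_le_cutoff hE hd i htT,
    optimalDelta_of_lt ((EReal.coe_lt_coe_iff.2 hst).trans_le htT)]
  exact (hE.monotone δs ps hs).1 i h0 ht hst

/-- Times before the cutoff produce only quantiles at or above the threshold, so below it both
suprema run over the same set; at 0 agreement near 0 suffices for the limits. -/
theorem IsSharpPath.cdfOfDelta_dagger (hs : E.IsSharpPath δs ps) (hE : E.IsRegular)
    (hd : E.IsDaggerPath (cutoff ps) δd) (i : Fin n) {u : ℝ} (hu0 : 0 ≤ u)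
    (hu : u < thresholdQuantile (cutoff ps) δs δd i) :
    cdfOfDelta {t : ℝ | cutoff ps ≤ (t : EReal)} (δd i) u = optimalForm ps δs δd i u := by
  have hpos : ∀ v, v < thresholdQuantile (cutoff ps) δs δd i →
      cdfOfDeltaPos {t : ℝ | cutoff ps ≤ (t : EReal)} (δd i) v =
        cdfOfDeltaPos {t | 0 ≤ t} (optimalDelta (cutoff ps) δs δd i) v := fun v hv => by
    refine congrArg sSup (Set.ext fun y => ⟨?_, ?_⟩)
    · rintro ⟨t, ht, htv, rfl⟩
      refine ⟨t, nonneg_of_cutoff_le ht, ?_⟩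
      rw [optimalDelta_of_le ht]
      exact ⟨htv, rfl⟩
    · rintro ⟨t, ht, htv, rfl⟩
      have htT : cutoff ps ≤ (t : EReal) := by
        by_contra! hlt
        rw [optimalDelta_of_lt hlt] at htv
        exact (hs.thresholdQuantile_le hE hd i ht hlt).not_gt (htv ▸ hv)
      rw [optimalDelta_of_le htT] at htv ⊢
      exact ⟨t, htT, htv, rfl⟩
  rcases hu0.eq_or_lt with rfl | hu0
  · rw [optimalForm, cdfOfDelta, cdfOfDelta, if_neg (lt_irrefl 0), if_neg (lt_irrefl 0), limUnder,
      limUnder]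
    congr 1
    refine Filter.map_congr ?_
    filter_upwards [Ioo_mem_nhdsGT hu] with v hv using hpos v hv.2
  · rw [optimalForm, cdfOfDelta, cdfOfDelta, if_pos hu0, if_pos hu0, hpos u hu]

/-- Below the threshold, the optimal form follows the zeros of marginal revenue. -/
theorem IsSharpPath.optimalForm_of_lt_thresholdQuantile (hs : E.IsSharpPath δs ps)
    (hE : E.IsRegular) (hd : E.IsDaggerPath (cutoff ps) δd)
    (hδ : ∀ i, IsDeltaPath (optimalDelta (cutoff ps) δs δd i))
    {q : Fin n → ℝ → ℝ} (hq : IsPrincipalVirtualValue δs ps q) (i : Fin n) {u : ℝ} (hu0 : 0 < u)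
    (hu : u < thresholdQuantile (cutoff ps) δs δd i) (hu1 : u ≤ 1)
    (hx : optimalForm ps δs δd i u ≠ 0) :
    optimalForm ps δs δd i u ≤ highScoreProb q i u ∧ q i u ≤ 0 ∧
      E.dH i (optimalForm ps δs δd i u) u = 0 ∧ E.dH i (highScoreProb q i u) u = q i u := by
  obtain ⟨t, ht, htu, htx⟩ := (hδ i).exists_first hu0 hu1 hx
  have htT : cutoff ps ≤ (t : EReal) := by
    by_contra! hlt
    rw [optimalDelta_of_lt hlt] at htu
    exact (hs.thresholdQuantile_le hE hd i ht hlt).not_gt (htu ▸ hu)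
  rw [optimalDelta_of_le htT] at htu htx
  obtain ⟨hdm, hd0⟩ := hd i t htT
  -- The sharp path is at least as high, so it reached the same quantile at some s ≤ t, on a higher
  -- hyperbola. Hence the highest-score probability is at least the optimal form.
  obtain ⟨s, hst, hδst⟩ := (hs.isDeltaPath hE i).exists_eq ht hdm.1 (hs.dagger_le hE hd i htT)
  have hsu : Real.exp (-δs i s) = u := by rw [hδst, htu]
  have hw : highScoreProb q i u = Real.exp (δs i s - s) := by
    rw [← hsu, hs.highScoreProb_exp hE hq i hst.1]
  have hqs : q i u = ps s := by rw [← hsu, hq.2 i s hst.1]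
  have hsT : cutoff ps ≤ (s : EReal) := by
    by_contra! hlt
    exact (hs.thresholdQuantile_le hE hd i hst.1 hlt).not_gt (hsu ▸ hu)
  have hxe : optimalForm ps δs δd i u = Real.exp (δd i t - t) := htx
  refine ⟨?_, ?_, ?_, ?_⟩
  · rw [hxe, hw, hδst]
    exact Real.exp_le_exp.2 (by linarith [hst.2])
  · rw [hqs]
    exact nonpos_of_cutoff_le (hE.monotone δs ps hs).2 (hs.continuousOn hE) hsT
  · rw [hxe, ← htu]
    exact hd0
  · rw [hw, hqs, ← (hs s hst.1).2.1 i, marginalRevenue, hsu]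

theorem IsSharpPath.optimalForm_le_highScoreProb (hs : E.IsSharpPath δs ps)
    (hE : E.IsRegular) (hd : E.IsDaggerPath (cutoff ps) δd)
    (hδ : ∀ i, IsDeltaPath (optimalDelta (cutoff ps) δs δd i))
    {q : Fin n → ℝ → ℝ} (hq : IsPrincipalVirtualValue δs ps q) (i : Fin n) {u : ℝ} (hu0 : 0 ≤ u)
    (hu : u < thresholdQuantile (cutoff ps) δs δd i) (hu1 : u < 1) :
    optimalForm ps δs δd i u ≤ highScoreProb q i u := by
  have hpos : ∀ v, 0 < v → v < thresholdQuantile (cutoff ps) δs δd i → v ≤ 1 →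
      optimalForm ps δs δd i v ≤ highScoreProb q i v := fun v hv0 hv hv1 => by
    by_cases hx : optimalForm ps δs δd i v = 0
    · rw [hx]
      exact (highScoreProb_mem q i v).1
    · exact (hs.optimalForm_of_lt_thresholdQuantile hE hd hδ hq i hv0 hv hv1 hx).1
  rcases hu0.eq_or_lt with rfl | hu0
  · have h1 : Tendsto (optimalForm ps δs δd i) (𝓝[>] 0) (𝓝 (optimalForm ps δs δd i 0)) :=
      (hδ i).cdfOfDelta_tendsto_zero
    have h2 : Tendsto (highScoreProb q i) (𝓝[>] 0) (𝓝 (highScoreProb q i 0)) :=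
      continuousWithinAt_Ioi_iff_Ici.2 (hq.1.highScoreProb_rightCts i 0 ⟨le_rfl, hu1⟩)
    refine le_of_tendsto_of_tendsto h1 h2 ?_
    filter_upwards [Ioo_mem_nhdsGT (lt_min hu hu1)] with v hv
    exact hpos v hv.1 (hv.2.trans_le (min_le_left _ _)) (hv.2.le.trans (min_le_right _ _))
  · exact hpos u hu0 hu hu1.le

theorem IsSharpPath.thresholdQuantile_le_one (hs : E.IsSharpPath δs ps) (hE : E.IsRegular)
    (hd : E.IsDaggerPath (cutoff ps) δd) (i : Fin n) :
    thresholdQuantile (cutoff ps) δs δd i ≤ 1 := by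
  rcases cutoff_eq_top_or_coe ps with hT | ⟨a, ha⟩
  · refine (hs.thresholdQuantile_le hE hd i le_rfl (hT ▸ EReal.coe_lt_top _)).trans ?_
    rw [(hs.isDeltaPath hE i).zero, neg_zero, Real.exp_zero]
  · rw [hs.thresholdQuantile_of_eq_coe hE hd i ha]
    exact (IsCDF.exp_neg_mem (hs.mem_Icc hE i (nonneg_of_cutoff_le ha.le)).1).2

theorem IsSharpPath.optimalFraction_of_lt (hs : E.IsSharpPath δs ps) (hE : E.IsRegular)
    (hd : E.IsDaggerPath (cutoff ps) δd) {q : Fin n → ℝ → ℝ}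
    (hq : IsPrincipalVirtualValue δs ps q) (i : Fin n) {u : ℝ} (hu0 : 0 ≤ u)
    (hu : u < thresholdQuantile (cutoff ps) δs δd i) :
    optimalFraction (cutoff ps) δs δd q i u =
      optimalForm ps δs δd i u / highScoreProb q i u := by
  rw [optimalFraction, if_neg hu.not_ge, hs.cdfOfDelta_dagger hE hd i hu0 hu,
    interim_one_eq_highScoreProb hq.1]

/-- The optimal form vanishes to the right of points with zero probability of a highest score. -/
theorem IsSharpPath.eventually_optimalForm_eq_zero (hs : E.IsSharpPath δs ps)
    (hE : E.IsRegular) (hd : E.IsDaggerPath (cutoff ps) δd)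
    (hδ : ∀ i, IsDeltaPath (optimalDelta (cutoff ps) δs δd i))
    {q : Fin n → ℝ → ℝ} (hq : IsPrincipalVirtualValue δs ps q) (i : Fin n) {u : ℝ} (hu0 : 0 ≤ u)
    (hu : u < thresholdQuantile (cutoff ps) δs δd i) (hu1 : u < 1)
    (hw : highScoreProb q i u = 0) :
    ∀ᶠ v in 𝓝[>] u, optimalForm ps δs δd i v = 0 := by
  by_contra hnot
  have hfreq : ∃ᶠ v in 𝓝[>] u, optimalForm ps δs δd i v ≠ 0 := not_eventually.1 hnot
  set θ := thresholdQuantile (cutoff ps) δs δd i with hθ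
  have hmem : Ioo u (min θ 1) ∈ 𝓝[>] u := Ioo_mem_nhdsGT (lt_min hu hu1)
  have hin : ∀ v ∈ Ioo u (min θ 1), 0 < v ∧ v < θ ∧ v < 1 := fun v hv =>
    ⟨hu0.trans_lt hv.1, (lt_min_iff.1 hv.2).1, (lt_min_iff.1 hv.2).2⟩
  have hwlim : Tendsto (highScoreProb q i) (𝓝[>] u) (𝓝 0) := by
    rw [← hw]
    exact continuousWithinAt_Ioi_iff_Ici.2 (hq.1.highScoreProb_rightCts i u ⟨hu0, hu1⟩)
  have hxlim : Tendsto (optimalForm ps δs δd i) (𝓝[>] u) (𝓝 0) := by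
    refine tendsto_of_tendsto_of_tendsto_of_le_of_le' tendsto_const_nhds hwlim ?_ ?_
    · filter_upwards [hmem] with v hv using IsDeltaPath.cdfOfDelta_nonneg_of_pos (hin v hv).1
    · filter_upwards [hmem] with v hv
      obtain ⟨h0, h1, h2⟩ := hin v hv
      exact hs.optimalForm_le_highScoreProb hE hd hδ hq i h0.le h1 h2
  have hqlim : Tendsto (q i) (𝓝[>] u) (𝓝 (q i u)) :=
    continuousWithinAt_Ioi_iff_Ici.2 ((hq.1 i).2 u ⟨hu0, hu1⟩)
  have hdH : ∀ y : ℝ → ℝ, Tendsto y (𝓝[>] u) (𝓝 0) →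
      (∀ v ∈ Ioo u (min θ 1), y v ∈ Icc (0 : ℝ) 1) →
      Tendsto (fun v => E.dH i (y v) v) (𝓝[>] u) (𝓝 (E.dH i 0 u)) := fun y hy hy1 => by
    refine (E.dH_continuousOn i (0, u) ⟨left_mem_Icc.2 zero_le_one, hu0, hu1.le⟩).tendsto.comp
      (tendsto_nhdsWithin_iff.2 ⟨hy.prodMk_nhds (tendsto_id.mono_left nhdsWithin_le_nhds), ?_⟩)
    filter_upwards [hmem] with v hv
    exact ⟨hy1 v hv, (hin v hv).1.le, (hin v hv).2.2.le⟩
  have h1 := hdH _ hwlim fun v _ => highScoreProb_mem q i v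
  have h2 := hdH _ hxlim fun v hv =>
    (hδ i).isCDF.1 v ⟨(hin v hv).1.le, (hin v hv).2.2.le⟩
  -- Both probabilities are squeezed to 0, so the two marginal revenues cancel in the limit and the
  -- expression tends to `q i u`. Where the optimal form is nonzero it equals q - q + 0 = 0, while
  -- strict monotonicity makes `q i u` negative: a contradiction.
  have hlim := (hqlim.sub h1).add h2
  rw [sub_add_cancel] at hlim
  have hgood := hfreq.and_eventually hmem
  have hlt : q i u < 0 := by
    obtain ⟨v, hvx, hv⟩ := hgood.exists
    obtain ⟨hv0, hvθ, hv1⟩ := hin v hv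
    exact ((hq.1 i).1 ⟨hu0, hu1.le⟩ ⟨hv0.le, hv1.le⟩ hv.1).trans_le
      (hs.optimalForm_of_lt_thresholdQuantile hE hd hδ hq i hv0 hvθ hv1.le hvx).2.1
  obtain ⟨v, ⟨hvx, hv⟩, hvlt⟩ := (hgood.and_eventually (hlim.eventually_lt_const hlt)).exists
  obtain ⟨hv0, hvθ, hv1⟩ := hin v hv
  obtain ⟨-, -, e1, e2⟩ :=
    hs.optimalForm_of_lt_thresholdQuantile hE hd hδ hq i hv0 hvθ hv1.le hvx
  rw [e1, e2] at hvlt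
  linarith

theorem IsSharpPath.isFractions_optimalFraction (hs : E.IsSharpPath δs ps)
    (hE : E.IsRegular) (hd : E.IsDaggerPath (cutoff ps) δd)
    (hδ : ∀ i, IsDeltaPath (optimalDelta (cutoff ps) δs δd i))
    {q : Fin n → ℝ → ℝ} (hq : IsPrincipalVirtualValue δs ps q) :
    IsFractions (optimalFraction (cutoff ps) δs δd q) := by
  intro i
  have hθ1 := hs.thresholdQuantile_le_one hE hd i
  set θ := thresholdQuantile (cutoff ps) δs δd i with hθ
  have hone : ∀ u, θ ≤ u → optimalFraction (cutoff ps) δs δd q i u = 1 := fun u hu => if_pos hu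
  refine ⟨fun u hu => ?_, fun u hu => ?_⟩
  · rcases le_or_gt θ u with h | h
    · rw [hone u h]
      exact right_mem_Icc.2 zero_le_one
    · rw [hs.optimalFraction_of_lt hE hd hq i hu.1 h]
      have hx : 0 ≤ optimalForm ps δs δd i u := ((hδ i).isCDF.1 u hu).1
      have hw := (highScoreProb_mem q i u).1
      exact ⟨div_nonneg hx hw, div_le_one_of_le₀
        (hs.optimalForm_le_highScoreProb hE hd hδ hq i hu.1 h (h.trans_le hθ1)) hw⟩
  · rcases le_or_gt θ u with h | h
    · refine (continuousWithinAt_const (b := (1 : ℝ))).congr (fun v hv => hone v ?_) (hone u h)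
      exact h.trans hv
    · have hu0 := hs.optimalFraction_of_lt hE hd hq i hu.1 h
      -- At a zero denominator the fraction is 0 by convention, and it stays 0 to the right because
      -- the numerator vanishes there.
      by_cases hw : highScoreProb q i u = 0
      · refine continuousWithinAt_Ioi_iff_Ici.1 ?_
        rw [ContinuousWithinAt, hu0, hw, div_zero]
        refine tendsto_const_nhds.congr' ?_
        filter_upwards [hs.eventually_optimalForm_eq_zero hE hd hδ hq i hu.1 h hu.2 hw,
          Ioo_mem_nhdsGT h] with v hv hv1
        rw [hs.optimalFraction_of_lt hE hd hq i (hu.1.trans hv1.1.le) hv1.2, hv, zero_div]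
      · refine (((hδ i).isCDF.2.2.1 u hu).div
          (hq.1.highScoreProb_rightCts i u hu) hw).congr_of_eventuallyEq ?_ hu0
        filter_upwards [Ico_mem_nhdsGE h] with v hv
        exact hs.optimalFraction_of_lt hE hd hq i (hu.1.trans hv.1) hv.2

theorem IsSharpPath.induces_optimalForm (hs : E.IsSharpPath δs ps)
    (hE : E.IsRegular) (hd : E.IsDaggerPath (cutoff ps) δd)
    (hδ : ∀ i, IsDeltaPath (optimalDelta (cutoff ps) δs δd i))
    {q : Fin n → ℝ → ℝ} (hq : IsPrincipalVirtualValue δs ps q) :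
    Induces (fractionalScoreAllocation q (optimalFraction (cutoff ps) δs δd q))
      (optimalForm ps δs δd) := by
  refine ⟨isAllocation_fractionalScoreAllocation hq.1
    (hs.isFractions_optimalFraction hE hd hδ hq), fun i => ?_⟩
  have hθ1 := hs.thresholdQuantile_le_one hE hd i
  rw [ae_restrict_iff' measurableSet_Icc]
  filter_upwards [compl_mem_ae_iff.2
    (measure_singleton (thresholdQuantile (cutoff ps) δs δd i))] with u hne hu
  rw [interim_fractionalScoreAllocation hq.1, ← highScoreProb]
  rcases lt_or_gt_of_ne (show u ≠ thresholdQuantile (cutoff ps) δs δd i from hne) with h | h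
  · rw [hs.optimalFraction_of_lt hE hd hq i hu.1 h]
    have hx : 0 ≤ optimalForm ps δs δd i u := ((hδ i).isCDF.1 u hu).1
    have hle := hs.optimalForm_le_highScoreProb hE hd hδ hq i hu.1 h (h.trans_le hθ1)
    -- A zero denominator forces a zero numerator by domination, so the convention 0/0 = 0 loses
    -- nothing.
    refine (div_mul_cancel_of_imp fun hw => ?_).symm
    exact le_antisymm (hw ▸ hle) hx
  · rw [optimalFraction, if_pos h.le, one_mul,
      hs.optimalForm_of_thresholdQuantile_lt hE hd hδ hq i h hu.2]

theorem IsSharpPath.isOptimal_optimalForm (hs : E.IsSharpPath δs ps)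
    (hE : E.IsRegular) (hd : E.IsDaggerPath (cutoff ps) δd)
    (hδ : ∀ i, IsDeltaPath (optimalDelta (cutoff ps) δs δd i)) :
    E.IsOptimal (optimalForm ps δs δd) := by
  -- Any admissible scores will do: the allocation they define is the certificate of feasibility.
  obtain ⟨q, hq⟩ := hs.exists_scores hE
  have hfeas : IsFeasible (optimalForm ps δs δd) := ⟨fun i => (hδ i).isCDF, fun u hu =>
    (hs.induces_optimalForm hE hd hδ hq).borderValue_le_one hu⟩
  have hanti := (hE.monotone δs ps hs).2
  -- The multiplier is the positive part of p♯, frozen at its time-0 value for negative times so as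
  -- to be antitone on the whole line. It vanishes from the cutoff on, where the heights need not
  -- sum to t.
  have hφ : Antitone fun t => max (ps (max t 0)) 0 := fun s t hst =>
    max_le_max (hanti.antitoneOn (mem_Ici.2 (le_max_right s 0)) (mem_Ici.2 (le_max_right t 0))
      (max_le_max hst le_rfl)) le_rfl
  have hφM : ∀ t, max (ps (max t 0)) 0 ≤ max (ps 0) 0 := fun t =>
    max_le_max (hanti.antitoneOn self_mem_Ici (mem_Ici.2 (le_max_right t 0))
      (le_max_right t 0)) le_rfl
  have htr : ∀ i t, 0 < t → deltaTransform (optimalForm ps δs δd i) t =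
      optimalDelta (cutoff ps) δs δd i t := fun i t ht => (hδ i).deltaTransform_cdfOfDelta ht.le
  refine hE.isOptimal_of_multiplier hfeas hφ (fun t => le_max_right _ _) hφM
    (fun i t ht => ?_) fun t ht => ?_
  · rw [htr i t ht, max_eq_left ht.le]
    rcases lt_or_ge (t : EReal) (cutoff ps) with h | h
    · rw [optimalDelta_of_lt h, (hs t ht.le).2.1 i, max_eq_left (pos_of_lt_cutoff ht.le h).le]
    · rw [optimalDelta_of_le h, (hd i t h).2,
        max_eq_right (nonpos_of_cutoff_le hanti (hs.continuousOn hE) h)]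
  · rw [max_eq_left ht.le]
    rcases lt_or_ge (t : EReal) (cutoff ps) with h | h
    · simp only [htr _ t ht, optimalDelta_of_lt h, (hs t ht.le).2.2, sub_self, mul_zero]
    · rw [max_eq_right (nonpos_of_cutoff_le hanti (hs.continuousOn hE) h), zero_mul]

end AuctionEnv

theorem theorem5 {n : ℕ} (E : AuctionEnv n) (hE : E.IsRegular)
    (δs : Fin n → ℝ → ℝ) (ps : ℝ → ℝ) (hs : E.IsSharpPath δs ps)
    (δd : Fin n → ℝ → ℝ) (hd : E.IsDaggerPath (cutoff ps) δd)
    (hslope : ∀ i (s t : ℝ), cutoff ps ≤ (s : EReal) → s ≤ t →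
      0 ≤ δd i t - δd i s ∧ δd i t - δd i s ≤ t - s) :
    ∃ x : Fin n → ℝ → ℝ, E.IsOptimal x ∧
      (∀ i (t : ℝ), 0 ≤ t → (t : EReal) < cutoff ps → deltaTransform (x i) t = δs i t) ∧
      (∀ i (t : ℝ), cutoff ps ≤ (t : EReal) → deltaTransform (x i) t = δd i t) ∧
      (∃ q, IsPrincipalVirtualValue δs ps q) ∧
      ∀ q, IsPrincipalVirtualValue δs ps q →
        IsFractions (optimalFraction (cutoff ps) δs δd q) ∧
        Induces (fractionalScoreAllocation q (optimalFraction (cutoff ps) δs δd q)) x := by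
  have hδ := hs.isDeltaPath_optimalDelta hE hd hslope
  refine ⟨AuctionEnv.optimalForm ps δs δd, hs.isOptimal_optimalForm hE hd hδ,
    fun i t ht hT => ?_, fun i t hT => ?_, hs.exists_scores hE, fun q hq =>
    ⟨hs.isFractions_optimalFraction hE hd hδ hq, hs.induces_optimalForm hE hd hδ hq⟩⟩
  · exact ((hδ i).deltaTransform_cdfOfDelta ht).trans (AuctionEnv.optimalDelta_of_lt hT)
  · exact ((hδ i).deltaTransform_cdfOfDelta (nonneg_of_cutoff_le hT)).trans
      (AuctionEnv.optimalDelta_of_le hT)
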